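/- Let $n,m\ge 0$ and $h\ge 1$ be integers and consider a system $\partial_t^h u^i=F^i$, $i=1,\dots,m$, in the independent variables $t,x_1,\dots,x_n$. Write $u^i_{s,I}=\partial_t^s\partial_x^I u^i$ for $0\le s<h$ and multi-indices $I\in\mathbb Z_{\ge0}^n$. Let $U$ be an open set in the space of the coordinates $t,x_j,u^i_{s,I}$ (product topology). All functions below are smooth functions on $U$ of finitely many of these coordinates. The $F^i$ depend only on $t$, $x_j$, the $u^b_{0,I}$ and the $u^a_{s,0}$, $s<h$. Let $D_{x_j}$ be the total derivatives, $D_x^I=D_{x_1}^{i_1}\cdots D_{x_n}^{i_n}$, and let $$D_t=\frac{\partial}{\partial t}+\sum_{k,I,\,s<h-1}u^k_{s+1,I}\frac{\partial}{\partial u^k_{s,I}}+\sum_{k,I}D_x^I(F^k)\frac{\partial}{\partial u^k_{h-1,I}}.$$ The order $\mathrm o(f)$ of a vector function $f$ is the maximal $|I|$ such that $\partial f/\partial u^i_{s,I}\not\equiv0$ on $U$ for some $s,i$, and $-1$ if there is none; $\mathrm t(f)$ is the maximal $s$ such that $\partial f/\partial u^i_{s,I}\not\equiv 0$ for some $i$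 and some $I$ with $|I|=\mathrm o(f)$. The symbol of $f$ is the matrix $\mathbf S_f$ with entries $\sum_{|I|=\mathrm o(f)}\frac{\partial f_i}{\partial u^j_{\mathrm t(f),I}}\,q^I$, which are polynomials in $q_1,\dots,q_n$ whose coefficients are functions on $U$. Put $F=(F^1,\dots,F^m)$, $N=\mathrm o(F)$, assume $N>0$, and let $A=\mathbf S_F$. Let $$[L]_{ij}=\sum_{I}(-1)^{|I|}D_x^I\circ\frac{\partial F^j}{\partial u^i_{0,I}}+\sum_{0<s<h}(-1)^sD_t^s\circ\frac{\partial F^j}{\partial u^i_{s,0}},$$ write $[L]_{ij}=\sum_K f^{ij}_KD_x^K+\sum_{0<r<h}g^{ij}_rD_t^r$ by the Leibniz rule, and set $O=\max_{i,j,K,r}\{-1,\ \mathrm o(f^{ij}_K)-N,\ \mathrm o(g^{ij}_r)-N\}$. A conserved current is a tuple $(J_0,J_1,\dots,J_n)$ with $D_tJ_0+\sum_jD_{x_j}J_j=0$ on $U$. The characteristic of the conservation law it represents is $\chi=(\chi_1,\dots,\chi_m)$, $\chi_i=\sum_I(-1)^{|I|}D_x^I\bigl(\partial J_0/\partial u^i_{h-1,I}\bigr)$,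 and the order of the conservation law is $\mathrm o(\chi)$. The symbols are regarded over a field as follows. Let $B$ be an $\mathbb R$-algebra of functions on $U$ that contains the coefficients of all entries of $A$ and $\mathbf S_\chi$, and let $\varphi:B\to k$ be a ring homomorphism to a field (for example, the evaluation at a point of $U$, with $k=\mathbb R$; or, if $B$ is an integral domain, the inclusion into its field of fractions). Applying $\varphi$ to the coefficients gives matrices $A^\varphi,\mathbf S_\chi^\varphi$ over the field $k(q_1,\dots,q_n)$. The invariant factors of an $m\times m$ matrix $M$ over a field $K$ are the monic polynomials $d_1\mid d_2\mid\dots\mid d_m$ in $K[\lambda]$ such that $M-\lambda\mathbf I=C_1\,\mathrm{diag}(d_1,\dots,d_m)\,C_2$ with $C_1,C_2$ invertible over $K[\lambda]$. A polynomial $d$ is skew if $d(-\lambda)=(-1)^{\deg d}d(\lambda)$. **Theorem.** Suppose that $N+h$ is odd and that the system has a conservation law of order greater than $O$, with characteristic $\chi$, whose symbol is nonsingular over $k(q_1,\dots,q_n)$, i.e. $\det\mathbf S_\chi^\varphi\ne0$. Then all invariant factors of $A^\varphi$ are skew, and its characteristic polynomial is skew. In particular $\mathrm{tr}\,A^\varphi=0$,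 and $\det A^\varphi=0$ if $m$ is odd. -/

import Mathlib

open scoped ContDiff

noncomputable section

namespace GenEvol

/-- Coordinates `t`, `x_j` and `u^i_{s,I}` (with `s < h`, `I` a multi-index in `n` variables)
on the infinite prolongation of a system `∂_t^h u^i = F^i`, `i = 1, …, m`. -/
inductive Coord (n m h : ℕ) : Type
  | t : Coord n m h
  | x (j : Fin n) : Coord n m h
  | u (s : Fin h) (i : Fin m) (I : Fin n →₀ ℕ) : Coord n m h

/-- Points are given by the values of all coordinates; the topology is the product topology. -/
abbrev Jet (n m h : ℕ) : Type := Coord n m h → ℝ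

/-- Functions of the coordinates. Only their values on the domain `U` under consideration matter. -/
abbrev JetFun (n m h : ℕ) : Type := Jet n m h → ℝ

/-- On `U`, the function `f` is a smooth function of finitely many coordinates from `V`. -/
def IsSmoothIn {n m h : ℕ} (V : Set (Coord n m h)) (U : Set (Jet n m h)) (f : JetFun n m h) :
    Prop :=
  ∃ T : Finset (Coord n m h), (T : Set (Coord n m h)) ⊆ V ∧
    ∃ g : (T → ℝ) → ℝ,
      ContDiffOn ℝ ∞ g ((fun (p : Jet n m h) (c : T) => p c) '' U) ∧
        ∀ p ∈ U, f p = g (fun c : T => p c)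

/-- The partial derivative with respect to the coordinate `c`. -/
def pd {n m h : ℕ} (c : Coord n m h) (f : JetFun n m h) : JetFun n m h :=
  open Classical in fun p => deriv (fun r : ℝ => f (Function.update p c r)) (p c)

/-- The total derivative with respect to `x_j`. -/
def Dx {n m h : ℕ} (j : Fin n) (f : JetFun n m h) : JetFun n m h := fun p =>
  pd (Coord.x j) f p +
    ∑ᶠ c : Fin h × Fin m × (Fin n →₀ ℕ),
      p (Coord.u c.1 c.2.1 (c.2.2 + Finsupp.single j 1)) * pd (Coord.u c.1 c.2.1 c.2.2) f p

/-- The iterated total derivative `D_{x_1}^{i_1} ⋯ D_{x_n}^{i_n}`, `I = (i_1, …, i_n)`. -/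
def DxI {n m h : ℕ} (I : Fin n →₀ ℕ) (f : JetFun n m h) : JetFun n m h :=
  (List.finRange n).foldr (fun j g => (Dx j)^[I j] g) f

/-- The total derivative with respect to `t` in virtue of the system `∂_t^h u^i = F^i`: it takes
`u^k_{s,I}` to `u^k_{s+1,I}` if `s < h - 1`, and `u^k_{h-1,I}` to `D_x^I (F^k)`. -/
def Dt {n m h : ℕ} (F : Fin m → JetFun n m h) (f : JetFun n m h) : JetFun n m h := fun p =>
  pd Coord.t f p +
    ∑ᶠ c : Fin h × Fin m × (Fin n →₀ ℕ),
      (if hs : (c.1 : ℕ) + 1 < h then p (Coord.u ⟨(c.1 : ℕ) + 1, hs⟩ c.2.1 c.2.2)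
        else DxI c.2.2 (F c.2.1) p) * pd (Coord.u c.1 c.2.1 c.2.2) f p

/-- The coordinates on which the right-hand sides `F^i` may depend: `t`, `x_j`, the pure space
derivatives `u^i_{0,I}` and the pure time derivatives `u^i_{s,0}`, `s < h`. -/
def admissible (n m h : ℕ) : Set (Coord n m h) :=
  {c | ∀ s i I, c = Coord.u s i I → (s : ℕ) = 0 ∨ I = 0}

/-- `(J₀, J_1, …, J_n)` is a conserved current on `U` of the system `∂_t^h u^i = F^i`. -/
def IsConservedCurrent {n m h : ℕ} (U : Set (Jet n m h)) (F : Fin m → JetFun n m h)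
    (J₀ : JetFun n m h) (J : Fin n → JetFun n m h) : Prop :=
  IsSmoothIn Set.univ U J₀ ∧ (∀ j, IsSmoothIn Set.univ U (J j)) ∧
    ∀ p ∈ U, Dt F J₀ p + ∑ j, Dx j (J j) p = 0

/-- The characteristic of the conservation law represented by a conserved current with
`t`-component `J₀`: `χ_i = ∑_I (-1)^|I| D_x^I (∂J₀ / ∂u^i_{h-1,I})`. -/
def characteristic {n m h : ℕ} [NeZero h] (J₀ : JetFun n m h) (i : Fin m) : JetFun n m h := fun p =>
  ∑ᶠ I : Fin n →₀ ℕ, (-1) ^ I.degree *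
    DxI I (pd (Coord.u ⟨h - 1, Nat.sub_lt (NeZero.pos h) one_pos⟩ i I) J₀) p

/-- The order `o(f)` of a vector function on `U`: the maximal `|I|` such that
`∂f/∂u^i_{s,I}` is not identically zero for some `s`, `i`, and `-1` if there is no such `I`. -/
def order {n m h : ℕ} {ι : Type*} (U : Set (Jet n m h)) (f : ι → JetFun n m h) : ℤ :=
  sSup (insert (-1) {d : ℤ | ∃ s i I, d = (I.degree : ℤ) ∧
    ∃ a, ∃ p ∈ U, pd (Coord.u s i I) (f a) p ≠ 0})

/-- `t(f)`: the maximal `s` such that `∂f/∂u^i_{s,I}` is not identically zero on `U` for some `i`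
and some `I` with `|I| = o(f)` (meaningful if `o(f) ≥ 0`). -/
def timeOrder {n m h : ℕ} [NeZero h] {ι : Type*} (U : Set (Jet n m h)) (f : ι → JetFun n m h) :
    Fin h :=
  open Classical in
  (Finset.univ.filter fun s : Fin h => ∃ i I, (I.degree : ℤ) = order U f ∧
    ∃ a, ∃ p ∈ U, pd (Coord.u s i I) (f a) p ≠ 0).sup id

/-- The matrix `S^{a,b}(f)`, with entries `∑_{|I| = a} (∂f_i/∂u^j_{b,I}) q^I`: polynomials in
`q_1, …, q_n` whose coefficients are functions on `U`. -/
def symbolAt {n m h : ℕ} {ι : Type*} (U : Set (Jet n m h)) (a : ℕ) (b : Fin h)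
    (f : ι → JetFun n m h) : Matrix ι (Fin m) (MvPolynomial (Fin n) (U → ℝ)) := fun i j =>
  ∑ I ∈ (Finset.univ : Finset (Fin n)).finsuppAntidiag a,
    MvPolynomial.monomial I (fun p : U => pd (Coord.u b j I) (f i) p)

/-- The symbol `S^{o(f),t(f)}(f)` of a vector function (meaningful if `o(f) ≥ 0`). -/
def symbol {n m h : ℕ} [NeZero h] {ι : Type*} (U : Set (Jet n m h)) (f : ι → JetFun n m h) :
    Matrix ι (Fin m) (MvPolynomial (Fin n) (U → ℝ)) :=
  symbolAt U (order U f).toNat (timeOrder U f) f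

/-- The adjoint linearized equation reads `(-1)^h D_t^h χ = L χ` with
`[L]_{ij} = ∑_I (-1)^|I| D_x^I ∘ ∂F^j/∂u^i_{0,I} + ∑_{0<s<h} (-1)^s D_t^s ∘ ∂F^j/∂u^i_{s,0}`.
By the Leibniz rule, `[L]_{ij} = ∑_K f_K^{ij} D_x^K + ∑_{0<r<h} g_r^{ij} D_t^r`.
This is the coefficient `f_K^{ij}`. -/
def coeffX {n m h : ℕ} [NeZero h] (F : Fin m → JetFun n m h) (i j : Fin m) (K : Fin n →₀ ℕ) :
    JetFun n m h := fun p =>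
  (∑ᶠ I : Fin n →₀ ℕ, (-1) ^ (K + I).degree * (∏ a, (((K + I) a).choose (K a) : ℝ)) *
      DxI I (pd (Coord.u 0 i (K + I)) (F j)) p) +
    if K = 0 then
      ∑ s : Fin h, if s = 0 then 0 else (-1) ^ (s : ℕ) * (Dt F)^[s] (pd (Coord.u s i 0) (F j)) p
    else 0

/-- The coefficient `g_r^{ij}`, `0 < r < h`, of the operator `L` described at `coeffX`. -/
def coeffT {n m h : ℕ} (F : Fin m → JetFun n m h) (i j : Fin m) (r : Fin h) :
    JetFun n m h := fun p =>
  ∑ s : Fin h, if r ≤ s then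
    (-1) ^ (s : ℕ) * ((s : ℕ).choose (r : ℕ) : ℝ) *
      (Dt F)^[(s : ℕ) - (r : ℕ)] (pd (Coord.u s i 0) (F j)) p
  else 0

/-- The number `O = max {-1, o(f_K^{ij}) - N, o(g_r^{ij}) - N}`, where `N = o(F^1, …, F^m)`. -/
def orderBound {n m h : ℕ} [NeZero h] (U : Set (Jet n m h)) (F : Fin m → JetFun n m h) : ℤ :=
  sSup (insert (-1)
    ({d : ℤ | ∃ i j K, d = order U (fun _ : Unit => coeffX F i j K) - order U F} ∪
      {d : ℤ | ∃ i j r, r ≠ 0 ∧ d = order U (fun _ : Unit => coeffT F i j r) - order U F}))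

/-- `d_1, …, d_k` are the invariant factors of `A`: monic polynomials, each dividing the next, with
`A - λ I = C₁ diag(d_1, …, d_k) C₂` for unimodular polynomial matrices `C₁`, `C₂`. -/
def IsInvariantFactors {K : Type*} [Field K] {k : ℕ} (A : Matrix (Fin k) (Fin k) K)
    (d : Fin k → Polynomial K) : Prop :=
  (∀ i, (d i).Monic) ∧ (∀ i j, i ≤ j → d i ∣ d j) ∧
    ∃ C₁ C₂ : Matrix (Fin k) (Fin k) (Polynomial K), IsUnit C₁.det ∧ IsUnit C₂.det ∧
      A.map Polynomial.C - Matrix.scalar (Fin k) Polynomial.X = C₁ * Matrix.diagonal d * C₂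

/-- A polynomial is skew if `d(-λ) = (-1)^(deg d) d(λ)`. -/
def IsSkew {K : Type*} [Field K] (d : Polynomial K) : Prop :=
  d.comp (-Polynomial.X) = (-1) ^ d.natDegree * d

/-- The matrix over the field `k(q_1, …, q_n)` obtained from a matrix with entries in
`B[q_1, …, q_n]` by applying `φ : B → k` to the coefficients of its entries. -/
def specialize {n m : ℕ} {B k : Type*} [CommRing B] [Field k] (φ : B →+* k)
    (M : Matrix (Fin m) (Fin m) (MvPolynomial (Fin n) B)) :
    Matrix (Fin m) (Fin m) (FractionRing (MvPolynomial (Fin n) k)) :=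
  M.map fun P => algebraMap (MvPolynomial (Fin n) k) (FractionRing (MvPolynomial (Fin n) k))
    (MvPolynomial.map φ P)

end GenEvol

end

open GenEvol

/-! Let `M` and `τ` be the space order and the time order of the characteristic `χ`. The variational
derivatives `δ/δu^i_s` annihilate the divergences `D_{x_j} J_j`, so applied to the conservation law
they give a recursion in `s` for `ψ_s = δJ₀/δu_s`. Eliminating every `ψ_s` except `ψ_{h-1} = χ`
leaves the adjoint linearized equation `(-1)^h D_t^h χ = L χ` (`adjoint_equation`,
`adjoint_equation_expanded`).

This equation is differentiated with respect to `u^j_{τ,I}` with `|I| = M + N`. On the left, `h`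
time steps lead from `u_τ` back to `u_τ` and use the system exactly once, which gives `(-1)^h S_χ A`
(`d_dt_iterate_top`). On the right only the coefficients at `D_x^K` with `|K| = N` contribute, which
gives `(-1)^N Aᵀ S_χ`. That the order exceeds `O` keeps the derivatives of the coefficients of `L`
out of the comparison (`symbol_identity`). Since `N + h` is odd, `S_χ A = -Aᵀ S_χ`
(`symbol_mul_symbol`).

Over the field the symbol `S` of `χ` is invertible, so `A` is similar to `-Aᵀ`; this settles
characteristic polynomial, trace and determinant. For the invariant factors, `S (A - λ) = -(A + λ)ᵀ
S` makes `A - λ` equivalent to the transpose of its own image under `λ ↦ -λ`, and the monic Smith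
form is unique (`eq_of_equiv_diagonal`).

The differential algebra takes place in an abstract ring with commuting partial derivatives
(`Partials`). The smooth functions on `U` form such a ring (`jetPartials`), and `Rep` links its
elements to functions on the jet space. -/

namespace GenEvol

/-! ### Linear algebra: uniqueness of the Smith form, and matrices with `S A = -Aᵀ S`. -/

open Polynomial Matrix

/-- If `P diag(e) = diag(d) Q` with `det P` a unit and both diagonals are divisibility chains,
then each `d i` divides `e i`. -/
theorem dvd_of_mul_diagonal_eq {R : Type*} [CommRing R] [IsDomain R] [GCDMonoid R] {m : ℕ}
    {d e : Fin m → R} (hd : ∀ i j, i ≤ j → d i ∣ d j) (he : ∀ i j, i ≤ j → e i ∣ e j)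
    (hd0 : ∀ i, d i ≠ 0) {P Q : Matrix (Fin m) (Fin m) R} (hP : IsUnit P.det)
    (h : P * Matrix.diagonal e = Matrix.diagonal d * Q) (r : Fin m) : d r ∣ e r := by
  obtain ⟨d', e', hg, hdd, hee⟩ : ∃ d' e' : R, IsUnit (gcd d' e') ∧
      d r = gcd (d r) (e r) * d' ∧ e r = gcd (d r) (e r) * e' := by
    obtain ⟨x, y, hu, hx, hy⟩ := extract_gcd (d r) (e r)
    exact ⟨x, y, hy, hu, hx⟩
  have hg0 : gcd (d r) (e r) ≠ 0 := fun h0 => hd0 r (by rw [hdd, h0, zero_mul])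
  -- Entrywise `P i j * e j = d i * Q i j`. For `j ≤ r ≤ i` the chains turn this into `d r ∣ P i j *
  -- e r`; cancelling the gcd leaves `d'`, which is coprime to `e'`.
  have hP' : ∀ i j, r ≤ i → j ≤ r → d' ∣ P i j := by
    intro i j hi hj
    have h1 : P i j * e j = d i * Q i j := by
      have := congrFun (congrFun h i) j
      rwa [Matrix.mul_diagonal, Matrix.diagonal_mul] at this
    have h2 : d r ∣ P i j * e r :=
      ((hd r i hi).trans ⟨Q i j, h1⟩).trans (mul_dvd_mul_left _ (he j r hj))
    have h3 : gcd (d r) (e r) * d' ∣ gcd (d r) (e r) * (P i j * e') := by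
      rw [← hdd, mul_left_comm, ← hee]
      exact h2
    have h4 : d' ∣ P i j * e' := (mul_dvd_mul_iff_left hg0).1 h3
    exact ((gcd_isUnit_iff_isRelPrime).1 hg).dvd_of_dvd_mul_right h4
  have hdet : d' ∣ P.det := by
    rw [Matrix.det_apply]
    refine Finset.dvd_sum fun σ _ => ?_
    -- Every permutation meets the block of rows `≥ r` and columns `≤ r`: otherwise `r + 1` columns
    -- would be mapped injectively into `r` rows. Hence `d'` divides each term of the determinant.
    obtain ⟨j, hj, hσ⟩ : ∃ j, j ≤ r ∧ r ≤ σ j := by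
      by_contra! hcon
      have := Finset.card_le_card_of_injOn (s := Finset.Iic r) (t := Finset.Iio r) σ
        (fun j hj => by simpa using hcon j (by simpa using hj)) (σ.injective.injOn)
      simp at this
    rw [Units.smul_def, zsmul_eq_mul]
    exact Dvd.dvd.mul_left ((hP' _ _ hσ hj).trans
      (Finset.dvd_prod_of_mem (fun i => P (σ i) i) (Finset.mem_univ j))) _
  have hu : IsUnit d' := isUnit_of_dvd_unit hdet hP
  rw [hdd]
  exact (hu.mul_right_dvd).2 (gcd_dvd_right _ _)

/-- Monic Smith forms of equivalent matrices coincide. -/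
theorem eq_of_equiv_diagonal {K : Type*} [Field K] {m : ℕ} {d e : Fin m → K[X]}
    (hdm : ∀ i, (d i).Monic) (hem : ∀ i, (e i).Monic)
    (hd : ∀ i j, i ≤ j → d i ∣ d j) (he : ∀ i j, i ≤ j → e i ∣ e j)
    {B₁ B₂ B₃ B₄ : Matrix (Fin m) (Fin m) K[X]} (h₁ : IsUnit B₁.det) (h₂ : IsUnit B₂.det)
    (h₃ : IsUnit B₃.det) (h₄ : IsUnit B₄.det)
    (h : B₁ * diagonal d * B₂ = B₃ * diagonal e * B₄) : d = e := by
  classical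
  let _ : GCDMonoid K[X] := UniqueFactorizationMonoid.toGCDMonoid _
  have key : ∀ {d e : Fin m → K[X]}, (∀ i, (d i).Monic) → (∀ i j, i ≤ j → d i ∣ d j) →
      (∀ i j, i ≤ j → e i ∣ e j) → ∀ {B₁ B₂ B₃ B₄ : Matrix (Fin m) (Fin m) K[X]},
      IsUnit B₁.det → IsUnit B₃.det → IsUnit B₄.det →
      B₁ * diagonal d * B₂ = B₃ * diagonal e * B₄ → ∀ r, d r ∣ e r := by
    intro d e hdm hd he B₁ B₂ B₃ B₄ h₁ h₃ h₄ h
    refine dvd_of_mul_diagonal_eq hd he (fun i => (hdm i).ne_zero) (P := B₁⁻¹ * B₃)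
      (Q := B₂ * B₄⁻¹) ?_ ?_
    · rw [det_mul]
      exact (Matrix.isUnit_nonsing_inv_det _ h₁).mul h₃
    · have h5 := congrArg (fun M => B₁⁻¹ * M * B₄⁻¹) h
      rw [← mul_assoc, ← mul_assoc, Matrix.nonsing_inv_mul _ h₁, one_mul, ← mul_assoc,
        ← mul_assoc, Matrix.mul_nonsing_inv_cancel_right _ _ h₄] at h5
      rw [← h5, mul_assoc]
  funext r
  exact Polynomial.eq_of_monic_of_associated (hdm r) (hem r) (associated_of_dvd_dvd
    (key hdm hd he h₁ h₃ h₄ h r) (key hem he hd h₃ h₁ h₂ h.symm r))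

/-- Substituting `-λ` turns `λ - A` into `-(λ + A)`, and the determinant of the negated matrix picks
up `(-1)^m`. -/
theorem charpoly_comp_neg_X {K : Type*} [CommRing K] {m : ℕ} (A : Matrix (Fin m) (Fin m) K) :
    A.charpoly.comp (-X) = (-1) ^ m * (-A).charpoly := by
  have h : (compRingHom (-X) : K[X] →+* K[X]).mapMatrix A.charmatrix = -(-A).charmatrix := by
    refine Matrix.ext fun i j => ?_
    by_cases hij : i = j
    · subst hij; simp; ring
    · simp [hij]
  rw [← coe_compRingHom_apply, charpoly, RingHom.map_det, h, det_neg, Fintype.card_fin, charpoly]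

variable {K : Type*} [Field K] {m : ℕ} {S A : Matrix (Fin m) (Fin m) K}

/-- Common source of the next three results: similarity invariants of `A` agree with those of `-Aᵀ`.
-/
theorem conj_eq_neg_transpose (hS : S.det ≠ 0) (h : S * A = -(Aᵀ * S)) :
    S * A * S⁻¹ = -Aᵀ := by
  rw [h, neg_mul, Matrix.mul_nonsing_inv_cancel_right _ _ (isUnit_iff_ne_zero.2 hS)]

theorem isSkew_charpoly_of_anticommute (hS : S.det ≠ 0) (h : S * A = -(Aᵀ * S)) :
    IsSkew A.charpoly := by
  have h1 : A.charpoly = (-A).charpoly := by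
    have hu : IsUnit S := (Matrix.isUnit_iff_isUnit_det _).2 (isUnit_iff_ne_zero.2 hS)
    obtain ⟨u, rfl⟩ := hu
    rw [← charpoly_units_conj u A, ← charpoly_transpose (-A), transpose_neg,
      ← conj_eq_neg_transpose hS h]
  rw [IsSkew, charpoly_comp_neg_X, ← h1, charpoly_natDegree_eq_dim, Fintype.card_fin]

theorem trace_eq_zero_of_anticommute [CharZero K] (hS : S.det ≠ 0) (h : S * A = -(Aᵀ * S)) :
    A.trace = 0 := by
  have h1 := congrArg trace (conj_eq_neg_transpose hS h)
  rw [trace_mul_comm, ← mul_assoc, Matrix.nonsing_inv_mul _ (isUnit_iff_ne_zero.2 hS), one_mul,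
    trace_neg, trace_transpose] at h1
  exact self_eq_neg.1 h1

theorem det_eq_zero_of_anticommute [CharZero K] (hS : S.det ≠ 0) (h : S * A = -(Aᵀ * S))
    (hm : Odd m) : A.det = 0 := by
  have h1 := congrArg det (conj_eq_neg_transpose hS h)
  rw [det_mul_comm, ← mul_assoc, Matrix.nonsing_inv_mul _ (isUnit_iff_ne_zero.2 hS), one_mul,
    det_neg, det_transpose, Fintype.card_fin, hm.neg_one_pow, neg_one_mul] at h1
  exact self_eq_neg.1 h1

/-- Substituting `-λ` in `A - λ = C₁ D C₂` diagonalizes `A + λ`. The relation `S (A - λ) = -(A + λ)ᵀ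
S` makes this second diagonal matrix equivalent to `D`, so uniqueness of the Smith form compares `d
i` with `d i (-λ)`. -/
theorem isSkew_of_isInvariantFactors (hS : S.det ≠ 0) (h : S * A = -(Aᵀ * S))
    {d : Fin m → K[X]} (hd : IsInvariantFactors A d) (i : Fin m) : IsSkew (d i) := by
  obtain ⟨hmon, hdvd, C₁, C₂, h1, h2, hA⟩ := hd
  set ν : K[X] →+* K[X] := compRingHom (-X) with hν
  set S' : Matrix (Fin m) (Fin m) K[X] := S.map C with hS'
  have hS'u : IsUnit S'.det := by
    have : S'.det = C S.det := by
      rw [RingHom.map_det]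
      rfl
    rw [this]
    exact (isUnit_iff_ne_zero.2 hS).map C
  have hνA : (A.map C + Matrix.scalar (Fin m) X : Matrix (Fin m) (Fin m) K[X]) =
      C₁.map ν * diagonal (fun i => ν (d i)) * C₂.map ν := by
    have := congrArg (fun M : Matrix (Fin m) (Fin m) K[X] => M.map ν) hA
    simp only [Matrix.map_mul] at this
    rw [Matrix.diagonal_map (map_zero ν)] at this
    refine Eq.trans ?_ this
    ext a b : 2
    simp only [Matrix.add_apply, Matrix.map_apply, Matrix.sub_apply, map_sub]
    by_cases hab : a = b
    · subst hab; simp [hν]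
    · simp [hν, hab]
  have key : S' * (A.map C - Matrix.scalar (Fin m) X) =
      -((A.map C + Matrix.scalar (Fin m) X)ᵀ * S') := by
    have h' : S' * A.map C = -((A.map C)ᵀ * S') := by
      rw [hS', ← Matrix.map_mul, h, ← Matrix.transpose_map, ← Matrix.map_mul]
      exact Matrix.map_neg _ (fun a => C_neg) _
    have h'' : S' * Matrix.scalar (Fin m) X = Matrix.scalar (Fin m) X * S' :=
      ((Matrix.scalar_commute (X : K[X]) (fun r => mul_comm _ _) S').eq).symm
    rw [mul_sub, h', h'', Matrix.transpose_add, add_mul]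
    simp [sub_eq_add_neg, add_comm]
  -- The sign makes `d i (-λ)` monic again; it is undone by the diagonal factor in `B₄` below.
  set e : Fin m → K[X] := fun i => (-1) ^ (d i).natDegree * ν (d i) with he
  have hsq : ∀ n : ℕ, ((-1) ^ n * (-1) ^ n : K[X]) = 1 := fun n => by
    rw [← mul_pow]; simp
  have hνd : ∀ i, ν (d i) = (-1) ^ (d i).natDegree * e i := fun i => by
    rw [he, ← mul_assoc, hsq, one_mul]
  have hde : d = e := by
    refine eq_of_equiv_diagonal (B₁ := S' * C₁) (B₂ := C₂) (B₃ := -(C₂.map ν)ᵀ)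
      (B₄ := diagonal (fun i => (-1) ^ (d i).natDegree) * (C₁.map ν)ᵀ * S')
      hmon (fun i => ?_) hdvd (fun i j hij => ?_) ?_ h2 ?_ ?_ ?_
    · change leadingCoeff ((-1) ^ (d i).natDegree * (d i).comp (-X)) = 1
      rw [ leadingCoeff_mul, leadingCoeff_pow, leadingCoeff_comp (by simp), hmon i]
      simp [← mul_pow]
    · have h3 : ν (d i) ∣ ν (d j) := map_dvd ν (hdvd i j hij)
      have hu : ∀ n : ℕ, IsUnit ((-1) ^ n : K[X]) := fun n => IsUnit.of_mul_eq_one _ (hsq n)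
      exact (hu _).mul_left_dvd.2 ((hu _).dvd_mul_left.2 h3)
    · rw [det_mul]; exact hS'u.mul h1
    · rw [det_neg, det_transpose]
      refine (IsUnit.of_mul_eq_one _ (hsq _)).mul ?_
      have := h2.map ν
      rwa [RingHom.map_det] at this
    · rw [det_mul, det_mul, det_transpose, det_diagonal]
      refine IsUnit.mul (IsUnit.mul ?_ ?_) hS'u
      · exact IsUnit.prod_univ_iff.2 fun i => IsUnit.of_mul_eq_one _ (hsq _)
      · have := h1.map ν
        rwa [RingHom.map_det] at this
    · rw [hνA, hA] at key
      rw [mul_assoc S', mul_assoc S', key]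
      have h4 : diagonal e * diagonal (fun i => (-1 : K[X]) ^ (d i).natDegree) =
          diagonal (fun i => ν (d i)) := by
        rw [diagonal_mul_diagonal]
        congr 1
        funext i
        rw [hνd, mul_comm]
      simp only [transpose_mul, diagonal_transpose, ← mul_assoc, neg_mul]
      rw [mul_assoc _ (diagonal e), h4]
  have : d i = (-1) ^ (d i).natDegree * ν (d i) := congrFun hde i
  rw [IsSkew]
  change ν (d i) = _
  conv_rhs => rw [this]
  rw [← mul_assoc]
  rw [show natDegree ((-1) ^ (d i).natDegree * ν (d i)) = (d i).natDegree by rw [← this], hsq,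
    one_mul]

end GenEvol

/-! ### Vector fields and total derivatives in an abstract ring with partial derivatives. -/

noncomputable section

namespace GenEvol

/-- Commuting, locally finite partial derivatives on a ring of functions of the coordinates `C`. -/
structure Partials (C R : Type*) [CommRing R] [Algebra ℝ R] where
  /-- the partial derivatives -/
  d : C → Derivation ℝ R R
  /-- the coordinate functions -/
  coord : C → R
  comm : ∀ a b f, d a (d b f) = d b (d a f)
  finite : ∀ f, {c | d c f ≠ 0}.Finite
  d_coord_self : ∀ c, d c (coord c) = 1
  d_coord_of_ne : ∀ {c c'}, c ≠ c' → d c (coord c') = 0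

namespace Partials

section VectorField

variable {C R : Type*} [CommRing R] [Algebra ℝ R] (P : Partials C R)

theorem finsum_eq_sum (a : C → R) (f : R) (T : Finset C) (hT : ∀ c ∉ T, P.d c f = 0) :
    ∑ᶠ c, a c * P.d c f = ∑ c ∈ T, a c * P.d c f :=
  finsum_eq_sum_of_support_subset _ fun c hc => by
    by_contra h
    exact hc (by simp only [hT c h, mul_zero])

theorem exists_finset (f : R) : ∃ T : Finset C, ∀ c ∉ T, P.d c f = 0 :=
  ⟨(P.finite f).toFinset, fun c hc => by simpa using hc⟩

theorem exists_finset₂ (f g : R) :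
    ∃ T : Finset C, (∀ c ∉ T, P.d c f = 0) ∧ ∀ c ∉ T, P.d c g = 0 := by
  classical
  obtain ⟨T₁, h₁⟩ := P.exists_finset f
  obtain ⟨T₂, h₂⟩ := P.exists_finset g
  exact ⟨T₁ ∪ T₂, fun c hc => h₁ c fun h => hc (Finset.mem_union_left _ h),
    fun c hc => h₂ c fun h => hc (Finset.mem_union_right _ h)⟩

/-- The vector field `∑ a_c ∂_c`. -/
def vf (a : C → R) : Derivation ℝ R R :=
  Derivation.mk'
    { toFun := fun f => ∑ᶠ c, a c * P.d c f
      map_add' := fun f g => by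
        obtain ⟨T, h₁, h₂⟩ := P.exists_finset₂ f g
        rw [P.finsum_eq_sum a f T h₁, P.finsum_eq_sum a g T h₂, P.finsum_eq_sum a (f + g) T
          fun c hc => by rw [map_add, h₁ c hc, h₂ c hc, add_zero], ← Finset.sum_add_distrib]
        simp [mul_add]
      map_smul' := fun r f => by
        obtain ⟨T, h₁⟩ := P.exists_finset f
        rw [P.finsum_eq_sum a f T h₁, P.finsum_eq_sum a (r • f) T
          fun c hc => by rw [Derivation.map_smul, h₁ c hc, smul_zero], RingHom.id_apply, Finset.smul_sum]
        simp }
    fun f g => by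
      obtain ⟨T, h₁, h₂⟩ := P.exists_finset₂ f g
      simp only [LinearMap.coe_mk, AddHom.coe_mk]
      rw [P.finsum_eq_sum a f T h₁, P.finsum_eq_sum a g T h₂, P.finsum_eq_sum a (f * g) T
        fun c hc => by rw [Derivation.leibniz, h₁ c hc, h₂ c hc, smul_zero, smul_zero, add_zero],
        smul_eq_mul, smul_eq_mul, Finset.mul_sum, Finset.mul_sum, ← Finset.sum_add_distrib]
      refine Finset.sum_congr rfl fun c _ => ?_
      rw [Derivation.leibniz, smul_eq_mul, smul_eq_mul]
      ring

theorem vf_apply (a : C → R) (f : R) : P.vf a f = ∑ᶠ c, a c * P.d c f := rfl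

theorem vf_eq_sum (a : C → R) (f : R) (T : Finset C) (hT : ∀ c ∉ T, P.d c f = 0) :
    P.vf a f = ∑ c ∈ T, a c * P.d c f := P.finsum_eq_sum a f T hT

theorem vf_coord (a : C → R) (c : C) : P.vf a (P.coord c) = a c := by
  rw [P.vf_eq_sum a _ {c} fun c' hc' => P.d_coord_of_ne (by simpa using hc'),
    Finset.sum_singleton, P.d_coord_self, mul_one]

/-- The partial derivatives commute, so the commutator of `∂_c` with `∑ a_e ∂_e` only differentiates
the coefficients. -/
theorem d_vf (c : C) (a : C → R) (f : R) :
    P.d c (P.vf a f) = P.vf a (P.d c f) + P.vf (fun e => P.d c (a e)) f := by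
  obtain ⟨T, hT⟩ := P.exists_finset f
  rw [P.vf_eq_sum a f T hT, P.vf_eq_sum a (P.d c f) T fun e he => by rw [P.comm, hT e he, map_zero],
    P.vf_eq_sum _ f T hT, map_sum, ← Finset.sum_add_distrib]
  refine Finset.sum_congr rfl fun e _ => ?_
  rw [Derivation.leibniz, P.comm c e, smul_eq_mul, smul_eq_mul]
  ring

/-- The second-order part is isolated because it is symmetric in `a` and `b`. Commutation of two
vector fields then reduces to their coefficients, as `vf_comm` records. -/
theorem vf_vf (a b : C → R) (f : R) (T : Finset C) (hT : ∀ c ∉ T, P.d c f = 0) :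
    P.vf a (P.vf b f) =
      P.vf (fun e => P.vf a (b e)) f + ∑ c ∈ T, ∑ e ∈ T, b c * a e * P.d e (P.d c f) := by
  rw [P.vf_eq_sum b f T hT, P.vf_eq_sum _ f T hT, map_sum, ← Finset.sum_add_distrib]
  refine Finset.sum_congr rfl fun c _ => ?_
  rw [Derivation.leibniz, smul_eq_mul, smul_eq_mul,
    P.vf_eq_sum a (P.d c f) T fun e he => by rw [P.comm, hT e he, map_zero], Finset.mul_sum,
    add_comm, mul_comm (P.d c f)]
  simp only [mul_assoc]

theorem vf_comm {a b : C → R} (h : ∀ c, P.vf a (b c) = P.vf b (a c)) (f : R) :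
    P.vf a (P.vf b f) = P.vf b (P.vf a f) := by
  obtain ⟨T, hT⟩ := P.exists_finset f
  rw [P.vf_vf a b f T hT, P.vf_vf b a f T hT, funext h, Finset.sum_comm]
  congr 1
  refine Finset.sum_congr rfl fun c _ => Finset.sum_congr rfl fun e _ => ?_
  rw [P.comm c e, mul_comm (b e)]

theorem vf_eq_zero {a : C → R} {f : R} (h : ∀ c, a c = 0 ∨ P.d c f = 0) : P.vf a f = 0 := by
  rw [vf_apply]
  refine finsum_eq_zero_of_forall_eq_zero fun c => ?_
  rcases h c with h | h <;> simp [h]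

end VectorField

section Total

variable {n m h : ℕ} {R : Type*} [CommRing R] [Algebra ℝ R] (P : Partials (Coord n m h) R)

/-- The coefficients of the total derivative with respect to `x_j`. -/
def dxCoeff (j : Fin n) : Coord n m h → R
  | .t => 0
  | .x j' => if j' = j then 1 else 0
  | .u s i I => P.coord (.u s i (I + Finsupp.single j 1))

/-- The total derivative with respect to `x_j`. -/
def dx (j : Fin n) : Derivation ℝ R R := P.vf (P.dxCoeff j)

theorem dx_coord_u (j : Fin n) (s : Fin h) (i : Fin m) (I : Fin n →₀ ℕ) :
    P.dx j (P.coord (.u s i I)) = P.coord (.u s i (I + Finsupp.single j 1)) :=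
  P.vf_coord _ _

theorem dx_comm (j k : Fin n) (f : R) : P.dx j (P.dx k f) = P.dx k (P.dx j f) := by
  refine P.vf_comm (fun c => ?_) f
  cases c with
  | t => simp [dxCoeff]
  | x j' =>
    simp only [dxCoeff]
    split_ifs <;> simp
  | u s i I =>
    simp only [dxCoeff]
    rw [P.vf_coord, P.vf_coord]
    simp only [dxCoeff, add_right_comm]

/-- The iterated total derivative, as a linear map. -/
def dxI (I : Fin n →₀ ℕ) : Module.End ℝ R :=
  ((List.finRange n).map fun j => (P.dx j : Module.End ℝ R) ^ I j).prod

@[simp]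
theorem dxI_zero : P.dxI 0 = 1 := by
  simp [dxI]

/-- `dxI` is an ordered product; commutativity moves the additional factor to the front. -/
theorem _root_.List.prod_map_pow_add_single {ι M : Type*} [DecidableEq ι] [Monoid M] (a : ι → M)
    (ha : ∀ i j, Commute (a i) (a j)) (j : ι) (I : ι →₀ ℕ) (l : List ι) (hl : l.Nodup) :
    (l.map fun k => a k ^ (I + Finsupp.single j 1 : ι →₀ ℕ) k).prod =
      (if j ∈ l then a j else 1) * (l.map fun k => a k ^ I k).prod := by
  induction l with
  | nil => simp
  | cons k l ih =>
    rw [List.nodup_cons] at hl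
    rw [List.map_cons, List.prod_cons, ih hl.2, List.map_cons, List.prod_cons]
    by_cases hk : j = k
    · subst hk
      simp [hl.1, pow_succ', mul_assoc]
    · have : (I + Finsupp.single j 1 : ι →₀ ℕ) k = I k := by
        simp [Ne.symm hk]
      rw [this]
      by_cases hj : j ∈ l
      · simp only [hj, if_true, List.mem_cons, or_true, ← mul_assoc, ((ha j k).pow_right _).eq]
      · simp [hj, hk]

theorem dxI_add_single (I : Fin n →₀ ℕ) (j : Fin n) :
    P.dxI (I + Finsupp.single j 1) = (P.dx j : Module.End ℝ R) * P.dxI I := by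
  have := List.prod_map_pow_add_single (fun j => (P.dx j : Module.End ℝ R))
    (fun i j => LinearMap.ext fun f => P.dx_comm i j f) j I _ (List.nodup_finRange n)
  simpa [dxI] using this

theorem dxI_add_single_apply (I : Fin n →₀ ℕ) (j : Fin n) (f : R) :
    P.dxI (I + Finsupp.single j 1) f = P.dx j (P.dxI I f) := by
  rw [dxI_add_single]; rfl

/-- Induction on multi-indices. -/
theorem _root_.Finsupp.induction_add_single {ι : Type*} {p : (ι →₀ ℕ) → Prop} (I : ι →₀ ℕ)
    (zero : p 0) (add_single : ∀ I j, p I → p (I + Finsupp.single j 1)) : p I := by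
  suffices ∀ J, p J → p (J + I) by simpa using this 0 zero
  induction I using Finsupp.induction_linear with
  | zero => simp
  | add f g hf hg => exact fun J hJ => by rw [← add_assoc]; exact hg _ (hf _ hJ)
  | single a b =>
    induction b with
    | zero => simp
    | succ b ih =>
      intro J hJ
      rw [Finsupp.single_add, ← add_assoc]
      exact add_single _ _ (ih J hJ)

theorem dx_dxI (I : Fin n →₀ ℕ) (j : Fin n) (f : R) :
    P.dx j (P.dxI I f) = P.dxI I (P.dx j f) := by
  induction I using Finsupp.induction_add_single with
  | zero => simp
  | add_single I k ih => rw [dxI_add_single_apply, dxI_add_single_apply, dx_comm, ih]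

theorem dxI_coord_u (s : Fin h) (i : Fin m) (I J : Fin n →₀ ℕ) :
    P.dxI J (P.coord (.u s i I)) = P.coord (.u s i (I + J)) := by
  induction J using Finsupp.induction_add_single with
  | zero => simp
  | add_single J k ih => rw [dxI_add_single_apply, ih, dx_coord_u, add_assoc]

/-- Among the coefficients of `D_{x_j}` only the one at `u_I` is the coordinate `u_{I+1_j}`, so the
commutator is the single term `∂/∂u_I`. -/
theorem d_dx_add_single (s : Fin h) (i : Fin m) (I : Fin n →₀ ℕ) (j : Fin n) (f : R) :
    P.d (.u s i (I + Finsupp.single j 1)) (P.dx j f) =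
      P.dx j (P.d (.u s i (I + Finsupp.single j 1)) f) + P.d (.u s i I) f := by
  rw [dx, d_vf]
  congr 1
  rw [vf_apply, finsum_eq_single _ (Coord.u s i I), dxCoeff, d_coord_self, one_mul]
  intro c hc
  cases c with
  | t => simp [dxCoeff]
  | x j' =>
    simp only [dxCoeff]
    split_ifs <;> simp
  | u s' i' I' =>
    rw [dxCoeff, d_coord_of_ne, zero_mul]
    intro h
    simp only [Coord.u.injEq, add_left_inj] at h
    exact hc (by rw [h.1, h.2.1, h.2.2])

theorem d_dx_of_eq_zero (s : Fin h) (i : Fin m) (I : Fin n →₀ ℕ) (j : Fin n) (hI : I j = 0)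
    (f : R) : P.d (.u s i I) (P.dx j f) = P.dx j (P.d (.u s i I) f) := by
  rw [dx, d_vf, add_eq_left]
  refine P.vf_eq_zero fun c => Or.inl ?_
  cases c with
  | t => simp [dxCoeff]
  | x j' =>
    simp only [dxCoeff]
    split_ifs <;> simp
  | u s' i' I' =>
    rw [dxCoeff, d_coord_of_ne]
    intro h
    simp only [Coord.u.injEq] at h
    rw [h.2.2] at hI
    simp at hI

/-- The coefficients of the total derivative with respect to `t`. -/
def dtCoeff (F : Fin m → R) : Coord n m h → R
  | .t => 1
  | .x _ => 0
  | .u s i I => if hs : (s : ℕ) + 1 < h then P.coord (.u ⟨(s : ℕ) + 1, hs⟩ i I) else P.dxI I (F i)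

/-- The total derivative with respect to `t`. -/
def dt (F : Fin m → R) : Derivation ℝ R R := P.vf (P.dtCoeff F)

/-- By `vf_comm` only coefficients are compared; at `u_{h-1,I}` both sides are `D_x^{I+1_j} F`. -/
theorem dt_dx (F : Fin m → R) (j : Fin n) (f : R) :
    P.dt F (P.dx j f) = P.dx j (P.dt F f) := by
  refine P.vf_comm (fun c => ?_) f
  cases c with
  | t => simp [dxCoeff, dtCoeff]
  | x j' =>
    simp only [dxCoeff, dtCoeff]
    split_ifs <;> simp
  | u s i I =>
    simp only [dxCoeff, dtCoeff]
    rw [P.vf_coord]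
    simp only [dtCoeff]
    split_ifs
    · rw [P.vf_coord]; rfl
    · rw [dxI_add_single_apply]; rfl

theorem dt_dxI (F : Fin m → R) (I : Fin n →₀ ℕ) (f : R) :
    P.dt F (P.dxI I f) = P.dxI I (P.dt F f) := by
  induction I using Finsupp.induction_add_single with
  | zero => simp
  | add_single I k ih => rw [dxI_add_single_apply, dxI_add_single_apply, dt_dx, ih]

end Total

end Partials

end GenEvol

end

/-! ### Adjoints of linearizations and variational derivatives. -/

noncomputable section

namespace GenEvol

theorem Coord.u_injective {n m h : ℕ} :
    Function.Injective fun c : Fin h × Fin m × (Fin n →₀ ℕ) =>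
      (Coord.u c.1 c.2.1 c.2.2 : Coord n m h) := by
  rintro ⟨s, i, I⟩ ⟨s', i', I'⟩ h
  simpa using h

theorem Coord.finsum_eq {n m h : ℕ} {M : Type*} [AddCommMonoid M] (φ : Coord n m h → M)
    (hφ : (Function.support φ).Finite) :
    ∑ᶠ c, φ c = φ .t + ∑ j, φ (.x j) +
      ∑ᶠ c : Fin h × Fin m × (Fin n →₀ ℕ), φ (.u c.1 c.2.1 c.2.2) := by
  have hu : (Set.univ : Set (Coord n m h)) = ({.t} ∪ Set.range .x) ∪
      Set.range fun c : Fin h × Fin m × (Fin n →₀ ℕ) => .u c.1 c.2.1 c.2.2 := by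
    ext c
    cases c <;> simp
  have hx : Function.Injective (Coord.x : Fin n → Coord n m h) := fun i j h => by simpa using h
  rw [← finsum_mem_univ, hu, finsum_mem_union' ?_ (hφ.inter_of_right _) (hφ.inter_of_right _),
    finsum_mem_union' ?_ (hφ.inter_of_right _) (hφ.inter_of_right _), finsum_mem_singleton,
    finsum_mem_range hx, finsum_mem_range Coord.u_injective, finsum_eq_sum_of_fintype]
  · rw [Set.disjoint_left]
    rintro _ rfl ⟨j, hj⟩
    simp at hj
  · rw [Set.disjoint_left]
    rintro _ h ⟨c, rfl⟩
    simp at h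

theorem finsum_triple {α β γ M : Type*} [Fintype α] [Fintype β] [AddCommMonoid M]
    (φ : α × β × γ → M) (hφ : (Function.support φ).Finite) :
    ∑ᶠ c, φ c = ∑ a, ∑ b, ∑ᶠ c, φ (a, b, c) := by
  rw [finsum_curry _ hφ, finsum_eq_sum_of_fintype]
  refine Finset.sum_congr rfl fun a _ => ?_
  rw [finsum_curry, finsum_eq_sum_of_fintype]
  exact (hφ.preimage (f := fun p : β × γ => (a, p)) (fun x _ y _ h => by simpa using h))

namespace Partials

variable {n m h : ℕ} {R : Type*} [CommRing R] [Algebra ℝ R] (P : Partials (Coord n m h) R)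

theorem finite_u (s : Fin h) (i : Fin m) (f : R) :
    {I : Fin n →₀ ℕ | P.d (.u s i I) f ≠ 0}.Finite :=
  (P.finite f).preimage (f := fun I => Coord.u s i I) fun I _ J _ h => by simpa using h

/-- The adjoint of the linearization of `Q` with respect to `u^i_{s,I}`:
`g ↦ ∑_I (-1)^|I| D_x^I (∂Q/∂u^i_{s,I} g)`. -/
def adj (s : Fin h) (i : Fin m) (Q : R) : Module.End ℝ R :=
  ∑ᶠ I : Fin n →₀ ℕ, (-1 : ℝ) ^ I.degree • (P.dxI I * LinearMap.mul ℝ R (P.d (.u s i I) Q))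

theorem adj_support (s : Fin h) (i : Fin m) (Q : R) :
    (Function.support fun I : Fin n →₀ ℕ =>
      (-1 : ℝ) ^ I.degree • (P.dxI I * LinearMap.mul ℝ R (P.d (.u s i I) Q))).Finite := by
  refine (P.finite_u s i Q).subset fun I hI h => hI ?_
  simp [h]

theorem adj_apply (s : Fin h) (i : Fin m) (Q g : R) :
    P.adj s i Q g =
      ∑ᶠ I : Fin n →₀ ℕ, (-1 : ℝ) ^ I.degree • P.dxI I (P.d (.u s i I) Q * g) := by
  have := (LinearMap.applyₗ (R := ℝ) (M₂ := R) g).toAddMonoidHom.map_finsum (P.adj_support s i Q)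
  simpa [adj] using this

theorem adj_apply_eq_sum (s : Fin h) (i : Fin m) (Q g : R) (T : Finset (Fin n →₀ ℕ))
    (hT : ∀ I ∉ T, P.d (.u s i I) Q = 0) :
    P.adj s i Q g = ∑ I ∈ T, (-1 : ℝ) ^ I.degree • P.dxI I (P.d (.u s i I) Q * g) := by
  rw [adj_apply]
  refine finsum_eq_sum_of_support_subset _ fun I hI => ?_
  by_contra h
  exact hI (by simp [hT I h])

theorem adj_apply_single (s : Fin h) (i : Fin m) (Q g : R)
    (hQ : ∀ I ≠ 0, P.d (.u s i I) Q = 0) : P.adj s i Q g = P.d (.u s i 0) Q * g := by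
  rw [P.adj_apply_eq_sum s i Q g {0} (by simpa using hQ)]
  simp

theorem adj_coord (s s' : Fin h) (i i' : Fin m) (g : R) :
    P.adj s i (P.coord (.u s' i' 0)) g = if s' = s ∧ i' = i then g else 0 := by
  rw [adj_apply_single]
  · split_ifs with h
    · rw [h.1, h.2, d_coord_self, one_mul]
    · rw [d_coord_of_ne, zero_mul]
      intro h'
      simp only [Coord.u.injEq] at h'
      exact h ⟨h'.1.symm, h'.2.1.symm⟩
  · intro I hI
    refine P.d_coord_of_ne fun h => hI ?_
    simp only [Coord.u.injEq] at h
    exact h.2.2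

theorem dx_mul_mul (j : Fin n) (a : R) :
    (P.dx j : Module.End ℝ R) * LinearMap.mul ℝ R a =
      LinearMap.mul ℝ R (P.dx j a) + LinearMap.mul ℝ R a * (P.dx j : Module.End ℝ R) := by
  ext f
  simp only [Module.End.mul_apply, LinearMap.mul_apply', Derivation.coeFn_coe,
    Derivation.leibniz, LinearMap.add_apply, smul_eq_mul]
  ring

theorem dxI_mul_dx (I : Fin n →₀ ℕ) (j : Fin n) :
    P.dxI I * (P.dx j : Module.End ℝ R) = P.dxI (I + Finsupp.single j 1) := by
  ext f
  rw [dxI_add_single_apply, dx_dxI]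
  rfl

/-- The linearization of `D_{x_j} Q` is `D_{x_j}` composed with that of `Q`, and the formal adjoint
of `D_{x_j}` is `-D_{x_j}`. -/
theorem adj_dx (s : Fin h) (i : Fin m) (j : Fin n) (Q : R) :
    P.adj s i (P.dx j Q) = -(P.adj s i Q * (P.dx j : Module.End ℝ R)) := by
  classical
  have hinj : Function.Injective fun I : Fin n →₀ ℕ => I + Finsupp.single j 1 :=
    add_left_injective _
  -- `∂(D_{x_j} Q)/∂u_I` splits into `D_{x_j}(∂Q/∂u_I)`, giving `A`, and a commutator term, giving
  -- `B`, which is supported on the shifted indices. With `a = ∂Q/∂u_I`, the identity `D_{x_j} ∘ a -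
  -- D_{x_j}(a) = a ∘ D_{x_j}` makes `A I + B (I + 1_j)` the `I`-th term of the right-hand side.
  set A : (Fin n →₀ ℕ) → Module.End ℝ R := fun I =>
    (-1 : ℝ) ^ I.degree • (P.dxI I * LinearMap.mul ℝ R (P.dx j (P.d (.u s i I) Q))) with hA
  set B : (Fin n →₀ ℕ) → Module.End ℝ R := fun I =>
    (-1 : ℝ) ^ I.degree • (P.dxI I * LinearMap.mul ℝ R
      (P.d (.u s i I) (P.dx j Q) - P.dx j (P.d (.u s i I) Q))) with hB
  have hB0 : ∀ I, I ∉ Set.range (fun I : Fin n →₀ ℕ => I + Finsupp.single j 1) → B I = 0 := by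
    intro I hI
    have : I j = 0 := by
      by_contra h0
      refine hI ⟨I - Finsupp.single j 1, ?_⟩
      exact tsub_add_cancel_of_le (Finsupp.single_le_iff.2 (Nat.one_le_iff_ne_zero.2 h0))
    rw [hB]
    simp only
    rw [d_dx_of_eq_zero _ _ _ _ _ this, sub_self, map_zero, mul_zero, smul_zero]
  have hB1 : ∀ I, B (I + Finsupp.single j 1) = -((-1 : ℝ) ^ I.degree •
      (P.dxI I * ((P.dx j : Module.End ℝ R) * LinearMap.mul ℝ R (P.d (.u s i I) Q)))) := by
    intro I
    rw [hB]
    simp only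
    rw [d_dx_add_single, add_sub_cancel_left, map_add, Finsupp.degree_single, pow_succ,
      ← dxI_mul_dx, mul_assoc, mul_neg_one]
    exact neg_smul ((-1 : ℝ) ^ I.degree) (_ : Module.End ℝ R)
  have hAf : (Function.support A).Finite := by
    refine (P.finite_u s i Q).subset fun I hI h => hI ?_
    simp [hA, h]
  have hBf : (Function.support B).Finite := by
    refine ((P.finite_u s i Q).union (P.finite_u s i (P.dx j Q))).subset fun I hI => ?_
    by_contra h
    simp only [Set.mem_union, Set.mem_ofPred_eq, not_or, not_not] at h
    exact hI (by simp [hB, h])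
  have h1 : P.adj s i (P.dx j Q) = ∑ᶠ I, (A I + B I) := by
    refine finsum_congr fun I => ?_
    rw [hA, hB]
    simp only
    rw [← smul_add, ← mul_add, ← map_add]
    simp
  have h2 : ∑ᶠ I, B I = ∑ᶠ I, B (I + Finsupp.single j 1) := by
    rw [← finsum_mem_range hinj, ← finsum_mem_univ]
    exact finsum_mem_inter_support_eq' _ _ _ fun I hI =>
      iff_of_true trivial (by_contra fun h => hI (hB0 I h))
  have hBf' : (Function.support fun I => B (I + Finsupp.single j 1)).Finite :=
    hBf.preimage hinj.injOn
  rw [h1, finsum_add_distrib hAf hBf, h2, ← finsum_add_distrib hAf hBf']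
  have h3 := (AddMonoidHom.mulRight (P.dx j : Module.End ℝ R)).map_finsum (P.adj_support s i Q)
  simp only [AddMonoidHom.coe_mulRight] at h3
  rw [adj, h3, ← finsum_neg_distrib]
  refine finsum_congr fun I => ?_
  rw [hB1, dx_mul_mul, hA, mul_add, smul_add, smul_mul_assoc, mul_assoc]
  simp only
  abel

theorem adj_dxI (s : Fin h) (i : Fin m) (J : Fin n →₀ ℕ) (Q : R) :
    P.adj s i (P.dxI J Q) = (-1 : ℝ) ^ J.degree • (P.adj s i Q * P.dxI J) := by
  induction J using Finsupp.induction_add_single with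
  | zero => simp
  | add_single J k ih =>
    rw [dxI_add_single_apply, adj_dx, ih, map_add, Finsupp.degree_single, pow_succ,
      ← dxI_mul_dx, smul_mul_assoc, mul_assoc, mul_neg_one]
    exact (neg_smul _ _).symm

/-- The right-hand sides of the system in the form `∂_t u^k_s = Q_{s,k}`. -/
def rhs (F : Fin m → R) (s : Fin h) (k : Fin m) : R :=
  if hs : (s : ℕ) + 1 < h then P.coord (.u ⟨(s : ℕ) + 1, hs⟩ k 0) else F k

theorem dtCoeff_u (F : Fin m → R) (s : Fin h) (k : Fin m) (J : Fin n →₀ ℕ) :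
    P.dtCoeff F (.u s k J) = P.dxI J (P.rhs F s k) := by
  rw [dtCoeff, rhs]
  split_ifs
  · rw [dxI_coord_u, zero_add]
  · rfl

theorem adj_one (s : Fin h) (i : Fin m) (g : R) : P.adj s i 1 g = 0 := by
  rw [adj_apply_single] <;> simp

theorem adj_zero (s : Fin h) (i : Fin m) (g : R) : P.adj s i 0 g = 0 := by
  rw [adj_apply_single] <;> simp

/-- Commuting `∂/∂u_{s,I}` past `D_t` differentiates the coefficients of `D_t`, which are `D_x^J` of
the right-hand sides. By `adj_dxI` this `D_x^J` moves onto `∂f/∂u_{s',J}`, and the sum over `J`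
reassembles the variational derivative of `f`. -/
theorem adj_dt_one (F : Fin m → R) (s : Fin h) (i : Fin m) (f : R) :
    P.adj s i (P.dt F f) 1 =
      P.dt F (P.adj s i f 1) + ∑ s', ∑ k, P.adj s i (P.rhs F s' k) (P.adj s' k f 1) := by
  classical
  obtain ⟨T, hT⟩ := P.exists_finset f
  have hd : ∀ I, P.d (.u s i I) (P.dt F f) = P.dt F (P.d (.u s i I) f) +
      ∑ e ∈ T, P.d (.u s i I) (P.dtCoeff F e) * P.d e f := by
    intro I
    rw [dt, d_vf, P.vf_eq_sum _ f T hT]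
  -- a finite set of multi-indices that is large enough for all sums
  have hS : ∃ S : Finset (Fin n →₀ ℕ), (∀ I ∉ S, P.d (.u s i I) f = 0) ∧
      ∀ e ∈ T, ∀ I ∉ S, P.d (.u s i I) (P.dtCoeff F e) = 0 := by
    refine ⟨(P.finite_u s i f).toFinset ∪
      T.biUnion fun e => (P.finite_u s i (P.dtCoeff F e)).toFinset, fun I hI => ?_,
      fun e he I hI => ?_⟩
    · simp only [Finset.mem_union, not_or] at hI
      simpa using hI.1
    · simp only [Finset.mem_union, Finset.mem_biUnion, not_or, not_exists, not_and] at hI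
      simpa using hI.2 e he
  obtain ⟨S, hS₁, hS₂⟩ := hS
  have h1 : P.adj s i (P.dt F f) 1 = P.dt F (P.adj s i f 1) +
      ∑ e ∈ T, P.adj s i (P.dtCoeff F e) (P.d e f) := by
    rw [P.adj_apply_eq_sum s i _ 1 S, P.adj_apply_eq_sum s i _ 1 S hS₁, map_sum,
      Finset.sum_congr rfl fun e he => P.adj_apply_eq_sum s i _ _ S (hS₂ e he), Finset.sum_comm,
      ← Finset.sum_add_distrib]
    · refine Finset.sum_congr rfl fun I _ => ?_
      rw [mul_one, mul_one, hd, map_add, Derivation.map_smul, dt_dxI, map_sum, smul_add,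
        Finset.smul_sum]
    · intro I hI
      rw [hd, hS₁ I hI, map_zero, zero_add]
      exact Finset.sum_eq_zero fun e he => by rw [hS₂ e he I hI, zero_mul]
  have hsub : (Function.support fun e => P.adj s i (P.dtCoeff F e) (P.d e f)) ⊆ T := by
    intro e he
    by_contra h
    exact he (by simp [hT e h])
  have h2 : ∑ e ∈ T, P.adj s i (P.dtCoeff F e) (P.d e f) =
      ∑ s', ∑ k, P.adj s i (P.rhs F s' k) (P.adj s' k f 1) := by
    rw [← finsum_eq_sum_of_support_subset _ hsub, Coord.finsum_eq _ (T.finite_toSet.subset hsub),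
      finsum_triple _ ((T.finite_toSet.subset hsub).preimage Coord.u_injective.injOn)]
    simp only [dtCoeff, adj_one, adj_zero, Finset.sum_const_zero, zero_add]
    refine Finset.sum_congr rfl fun s' _ => Finset.sum_congr rfl fun k _ => ?_
    have hfin : (Function.support fun I : Fin n →₀ ℕ =>
        (-1 : ℝ) ^ I.degree • P.dxI I (P.d (.u s' k I) f * 1)).Finite := by
      refine (P.finite_u s' k f).subset fun I hI h => hI ?_
      simp [h]
    have hmap := (P.adj s i (P.rhs F s' k)).toAddMonoidHom.map_finsum hfin
    simp only [LinearMap.toAddMonoidHom_coe] at hmap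
    rw [P.adj_apply s' k f 1, hmap]
    refine finsum_congr fun J => ?_
    have := P.dtCoeff_u F s' k J
    rw [dtCoeff] at this
    rw [this, adj_dxI, LinearMap.map_smul, mul_one]
    rfl
  rw [h1, h2]

end Partials

end GenEvol

end

/-! ### The adjoint linearized equation and its expansion by the Leibniz rule. -/

noncomputable section

namespace GenEvol

open Finset

theorem _root_.Derivation.iterate_apply_mul {A R : Type*} [CommRing A] [CommRing R] [Algebra A R]
    (D : Derivation A R R) (s : ℕ) (a b : R) :
    D^[s] (a * b) = ∑ r ∈ range (s + 1), (s.choose r : R) * D^[s - r] a * D^[r] b := by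
  have key : D^[s] (a * b) =
      ∑ ij ∈ antidiagonal s, s.choose ij.1 • (D^[ij.1] b * D^[ij.2] a) := by
    induction s with
    | zero => simp [mul_comm]
    | succ s ih =>
      rw [sum_antidiagonal_choose_succ_nsmul (fun i j => D^[i] b * D^[j] a) s,
        Function.iterate_succ_apply', ih, map_sum, ← sum_add_distrib]
      refine sum_congr rfl fun ij hij => ?_
      simp only [map_nsmul, Derivation.leibniz, Function.iterate_succ_apply', smul_eq_mul]
      rw [s.choose_symm_of_eq_add (HasAntidiagonal.mem_antidiagonal.1 hij).symm, ← smul_add]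
      ring
  rw [key, Nat.sum_antidiagonal_eq_sum_range_succ
    (fun i j => s.choose i • (D^[i] b * D^[j] a))]
  refine sum_congr rfl fun r _ => ?_
  rw [nsmul_eq_mul]
  ring

/-- The product of binomial coefficients `∏ (K_a + L_a choose K_a)`. -/
def multichoose {n : ℕ} (K L : Fin n →₀ ℕ) : ℝ := ∏ a, (((K + L) a).choose (K a) : ℝ)

theorem multichoose_zero_right {n : ℕ} (K : Fin n →₀ ℕ) : multichoose K 0 = 1 := by
  simp [multichoose]

/-- Pascal's rule in the `j`-th factor, the other factors being unchanged. The conditions supply the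
zero terms where truncated subtraction would return the index itself. -/
theorem multichoose_pascal {n : ℕ} (K L : Fin n →₀ ℕ) (j : Fin n) (hj : (K + L) j ≠ 0) :
    multichoose K L = (if K j = 0 then 0 else multichoose (K - Finsupp.single j 1) L) +
      (if L j = 0 then 0 else multichoose K (L - Finsupp.single j 1)) := by
  have hprod : ∀ K L : Fin n →₀ ℕ, multichoose K L =
      (((K j + L j).choose (K j) : ℕ) : ℝ) *
        ∏ a ∈ univ.erase j, (((K + L) a).choose (K a) : ℝ) := fun K L => by
    rw [multichoose, ← mul_prod_erase _ _ (mem_univ j)]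
    simp
  have h1 : ∏ a ∈ univ.erase j, (((K - Finsupp.single j 1 + L : Fin n →₀ ℕ) a).choose
      ((K - Finsupp.single j 1 : Fin n →₀ ℕ) a) : ℝ) = ∏ a ∈ univ.erase j, (((K + L) a).choose (K a) : ℝ) :=
    prod_congr rfl fun a ha => by simp [(ne_of_mem_erase ha).symm]
  have h2 : ∏ a ∈ univ.erase j, (((K + (L - Finsupp.single j 1) : Fin n →₀ ℕ) a).choose (K a) : ℝ) =
      ∏ a ∈ univ.erase j, (((K + L) a).choose (K a) : ℝ) :=
    prod_congr rfl fun a ha => by simp [(ne_of_mem_erase ha).symm]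
  have h3 : ∀ (p : Prop) [Decidable p] (x y : ℝ),
      (if p then 0 else x * y) = (if p then 0 else x) * y := fun p _ x y => by split_ifs <;> simp
  rw [hprod K L, hprod (K - _) L, hprod K (L - _), h1, h2, h3, h3, ← add_mul]
  congr 1
  simp only [Finsupp.coe_tsub, Pi.sub_apply, Finsupp.single_eq_same]
  obtain hK | ⟨k, hK⟩ := (K j).eq_zero_or_eq_succ_pred.imp_right fun h =>
      (⟨_, h⟩ : ∃ k, K j = k + 1)
  · rw [hK]
    have : L j ≠ 0 := by simpa [hK] using hj
    simp [this]
  · obtain hL | ⟨l, hL⟩ := (L j).eq_zero_or_eq_succ_pred.imp_right fun h =>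
      (⟨_, h⟩ : ∃ l, L j = l + 1)
    · rw [hL, hK]
      simp
    · rw [hL, hK]
      simp only [Nat.add_one_ne_zero, if_false, Nat.add_sub_cancel]
      rw [← Nat.cast_add, ← add_assoc, Nat.choose_succ_succ]
      congr 3
      omega

/-- Induction step of the Leibniz rule: one more `D_{x_j}` falls on either factor. -/
theorem sum_antidiagonal_multichoose {n : ℕ} {M : Type*} [AddCommGroup M] [Module ℝ M]
    (G : (Fin n →₀ ℕ) → (Fin n →₀ ℕ) → M) (I : Fin n →₀ ℕ) (j : Fin n) :
    ∑ p ∈ antidiagonal (I + Finsupp.single j 1), multichoose p.1 p.2 • G p.1 p.2 =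
      ∑ p ∈ antidiagonal I, multichoose p.1 p.2 •
        (G (p.1 + Finsupp.single j 1) p.2 + G p.1 (p.2 + Finsupp.single j 1)) := by
  set e : Fin n →₀ ℕ := Finsupp.single j 1 with he
  have hej : e j = 1 := by simp [he]
  have hle : ∀ {K : Fin n →₀ ℕ}, K j ≠ 0 → e ≤ K := fun h =>
    Finsupp.single_le_iff.2 (Nat.one_le_iff_ne_zero.2 h)
  have h1 : ∑ p ∈ antidiagonal (I + e), multichoose p.1 p.2 • G p.1 p.2 =
      ∑ p ∈ antidiagonal (I + e) with p.1 j ≠ 0, multichoose (p.1 - e) p.2 • G p.1 p.2 +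
      ∑ p ∈ antidiagonal (I + e) with p.2 j ≠ 0, multichoose p.1 (p.2 - e) • G p.1 p.2 := by
    rw [sum_filter, sum_filter, ← sum_add_distrib]
    refine sum_congr rfl fun p hp => ?_
    rw [HasAntidiagonal.mem_antidiagonal] at hp
    rw [multichoose_pascal p.1 p.2 j (by rw [hp]; simp [hej]), add_smul, ite_smul, ite_smul]
    simp only [zero_smul, ite_not]
    rfl
  rw [h1]
  simp only [smul_add]
  rw [sum_add_distrib]
  congr 1
  · refine sum_nbij' (fun p => (p.1 - e, p.2)) (fun p => (p.1 + e, p.2)) ?_ ?_ ?_ ?_ ?_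
    · rintro ⟨K, L⟩ hp
      rw [mem_filter, HasAntidiagonal.mem_antidiagonal] at hp
      rw [HasAntidiagonal.mem_antidiagonal]
      refine add_right_cancel (b := e) ?_
      simp only at hp ⊢
      rw [add_right_comm, tsub_add_cancel_of_le (hle hp.2), hp.1]
    · rintro ⟨K, L⟩ hp
      rw [HasAntidiagonal.mem_antidiagonal] at hp
      simp only at hp
      rw [mem_filter, HasAntidiagonal.mem_antidiagonal]
      exact ⟨by rw [← hp, add_right_comm], by simp [hej]⟩
    · rintro ⟨K, L⟩ hp
      rw [mem_filter] at hp
      simp [tsub_add_cancel_of_le (hle hp.2)]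
    · rintro ⟨K, L⟩ hp
      simp
    · rintro ⟨K, L⟩ hp
      rw [mem_filter] at hp
      simp [tsub_add_cancel_of_le (hle hp.2)]
  · refine sum_nbij' (fun p => (p.1, p.2 - e)) (fun p => (p.1, p.2 + e)) ?_ ?_ ?_ ?_ ?_
    · rintro ⟨K, L⟩ hp
      rw [mem_filter, HasAntidiagonal.mem_antidiagonal] at hp
      rw [HasAntidiagonal.mem_antidiagonal]
      refine add_right_cancel (b := e) ?_
      simp only at hp ⊢
      rw [add_assoc, tsub_add_cancel_of_le (hle hp.2), hp.1]
    · rintro ⟨K, L⟩ hp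
      rw [HasAntidiagonal.mem_antidiagonal] at hp
      simp only at hp
      rw [mem_filter, HasAntidiagonal.mem_antidiagonal]
      exact ⟨by rw [← hp, add_assoc], by simp [hej]⟩
    · rintro ⟨K, L⟩ hp
      rw [mem_filter] at hp
      simp [tsub_add_cancel_of_le (hle hp.2)]
    · rintro ⟨K, L⟩ hp
      simp
    · rintro ⟨K, L⟩ hp
      rw [mem_filter] at hp
      simp [tsub_add_cancel_of_le (hle hp.2)]

namespace Partials

variable {n m h : ℕ} {R : Type*} [CommRing R] [Algebra ℝ R] (P : Partials (Coord n m h) R)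

/-- The Leibniz rule for iterated total derivatives. -/
theorem dxI_mul_apply (I : Fin n →₀ ℕ) (a b : R) :
    P.dxI I (a * b) =
      ∑ p ∈ antidiagonal I, multichoose p.1 p.2 • (P.dxI p.2 a * P.dxI p.1 b) := by
  induction I using Finsupp.induction_add_single with
  | zero => simp [multichoose]
  | add_single I j ih =>
    rw [dxI_add_single_apply, ih, map_sum,
      sum_antidiagonal_multichoose (fun K L => P.dxI L a * P.dxI K b)]
    refine sum_congr rfl fun p _ => ?_
    rw [Derivation.map_smul, Derivation.leibniz, dxI_add_single_apply, dxI_add_single_apply]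
    simp only [smul_eq_mul]
    rw [mul_comm (P.dxI p.1 b)]

theorem adj_add (s : Fin h) (i : Fin m) (Q Q' g : R) :
    P.adj s i (Q + Q') g = P.adj s i Q g + P.adj s i Q' g := by
  obtain ⟨T, h₁, h₂⟩ : ∃ T : Finset (Fin n →₀ ℕ), (∀ I ∉ T, P.d (.u s i I) Q = 0) ∧
      ∀ I ∉ T, P.d (.u s i I) Q' = 0 := by
    classical
    refine ⟨(P.finite_u s i Q).toFinset ∪ (P.finite_u s i Q').toFinset, fun I hI => ?_,
      fun I hI => ?_⟩ <;> simp only [mem_union, not_or] at hI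
    · simpa using hI.1
    · simpa using hI.2
  rw [P.adj_apply_eq_sum s i _ g T h₁, P.adj_apply_eq_sum s i _ g T h₂,
    P.adj_apply_eq_sum s i _ g T fun I hI => by rw [map_add, h₁ I hI, h₂ I hI, add_zero],
    ← sum_add_distrib]
  simp only [map_add, add_mul, smul_add]

theorem adj_sum {ι : Type*} (T : Finset ι) (s : Fin h) (i : Fin m) (Q : ι → R) (g : R) :
    P.adj s i (∑ j ∈ T, Q j) g = ∑ j ∈ T, P.adj s i (Q j) g := by
  classical
  induction T using Finset.induction_on with
  | empty => simp [adj_zero]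
  | insert j T hj ih => rw [sum_insert hj, sum_insert hj, adj_add, ih]

/-- By `adj_dx` the variational derivative of `D_{x_j} J_j` contains the factor `D_{x_j} 1 = 0`, so
only the contribution of `adj_dt_one` remains. -/
theorem adj_conservation (F : Fin m → R) {J₀ : R} {J : Fin n → R} (hJ : P.dt F J₀ + ∑ j, P.dx j (J j) = 0)
    (s : Fin h) (i : Fin m) :
    P.dt F (P.adj s i J₀ 1) + (∑ s', ∑ k, P.adj s i (P.rhs F s' k) (P.adj s' k J₀ 1)) = 0 := by
  have hdx : ∀ j, P.adj s i (P.dx j (J j)) 1 = 0 := fun j => by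
    rw [adj_dx]
    simp
  have := congrArg (fun Q => P.adj s i Q 1) hJ
  simp only [adj_add, adj_sum, hdx, adj_zero, sum_const_zero, add_zero] at this
  rw [← adj_dt_one, this]

/-- Before the last time index the right-hand side is the coordinate `u_{s'+1}`, whose linearization
is trivial; `F` enters only at `s' = h - 1`. -/
theorem sum_adj_rhs (F : Fin m → R) (s s' : Fin h) (i : Fin m) (ψ : Fin m → R) :
    ∑ k, P.adj s i (P.rhs F s' k) (ψ k) =
      if (s' : ℕ) + 1 < h then (if (s' : ℕ) + 1 = s then ψ i else 0)
      else ∑ k, P.adj s i (F k) (ψ k) := by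
  simp only [rhs]
  split_ifs with h₁ h₂
  · simp only [adj_coord, h₂, true_and]
    rw [sum_ite_eq' univ i, if_pos (mem_univ _)]
  · simp only [adj_coord, Fin.ext_iff (b := s), h₂, false_and, if_false, sum_const_zero]
  · rfl

section Adjoint

variable [NeZero h] (F : Fin m → R)

/-- The last time index `h - 1`. -/
def _root_.GenEvol.lastTime (h : ℕ) [NeZero h] : Fin h :=
  ⟨h - 1, Nat.sub_lt (NeZero.pos h) one_pos⟩

/-- The equations for `ψ_{s,i} = δJ₀/δu^i_s`. -/
theorem adj_recursion {J₀ : R} {J : Fin n → R} (hJ : P.dt F J₀ + ∑ j, P.dx j (J j) = 0)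
    (s : Fin h) (i : Fin m) :
    P.dt F (P.adj s i J₀ 1) + ((if _hs : (s : ℕ) = 0 then 0 else
      P.adj ⟨(s : ℕ) - 1, (Nat.sub_le _ _).trans_lt s.2⟩ i J₀ 1) +
      ∑ k, P.adj s i (F k) (P.adj (lastTime h) k J₀ 1)) = 0 := by
  refine Eq.trans ?_ (P.adj_conservation F hJ s i)
  congr 1
  simp only [P.sum_adj_rhs F s _ i fun k => P.adj _ k J₀ 1]
  rw [← sum_erase_add _ _ (mem_univ (lastTime h))]
  have h1 : ¬ ((lastTime h : Fin h) : ℕ) + 1 < h := by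
    have := NeZero.pos h
    simp only [lastTime]
    omega
  rw [if_neg h1]
  congr 1
  have h2 : ∀ s' ∈ univ.erase (lastTime h), (if (s' : ℕ) + 1 < h then
      (if (s' : ℕ) + 1 = s then P.adj s' i J₀ 1 else 0)
      else ∑ k, P.adj s i (F k) (P.adj s' k J₀ 1)) =
      if (s' : ℕ) + 1 = s then P.adj s' i J₀ 1 else 0 := by
    intro s' hs'
    rw [if_pos]
    have h3 : (s' : ℕ) ≠ h - 1 := fun h => ne_of_mem_erase hs' (Fin.ext h)
    have := s'.2
    omega
  rw [sum_congr rfl h2]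
  split_ifs with hs
  · exact (sum_eq_zero fun s' _ => by rw [if_neg (by omega)]).symm
  · rw [sum_eq_single ⟨(s : ℕ) - 1, (Nat.sub_le _ _).trans_lt s.2⟩]
    · rw [if_pos]
      simp only
      omega
    · intro s' _ hs'
      rw [if_neg]
      intro h
      exact hs' (Fin.ext (by simp only; omega))
    · intro hmem
      refine absurd (mem_erase.2 ⟨fun h => ?_, mem_univ _⟩) hmem
      have h4 := congrArg Fin.val h
      have := s.2
      simp only [lastTime] at h4
      omega

/-- The characteristic satisfies the adjoint linearized equation. -/
theorem adjoint_equation {J₀ : R} {J : Fin n → R} (hJ : P.dt F J₀ + ∑ j, P.dx j (J j) = 0)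
    (i : Fin m) :
    (-1 : ℝ) ^ h • (P.dt F)^[h] (P.adj (lastTime h) i J₀ 1) =
      ∑ s : Fin h, (-1 : ℝ) ^ (s : ℕ) •
        (P.dt F)^[s] (∑ k, P.adj s i (F k) (P.adj (lastTime h) k J₀ 1)) := by
  set G : Fin h → R := fun s => ∑ k, P.adj s i (F k) (P.adj (lastTime h) k J₀ 1) with hG
  set D : Module.End ℝ R := (P.dt F : Module.End ℝ R) with hD
  have hDi : ∀ s f, (P.dt F)^[s] f = (D ^ s) f := fun s f => (Module.End.pow_apply D s f).symm
  -- Applying `(-1)^s D_t^s` to the recursion and summing telescopes; the sum up to `r` leaves only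
  -- `ψ_r`, and `r = h - 1` is the claim.
  have key : ∀ r (hr : r < h), ∑ s : Fin h, (if (s : ℕ) ≤ r then
      (-1 : ℝ) ^ (s : ℕ) • (D ^ (s : ℕ)) (G s) else 0) =
      (-1 : ℝ) ^ (r + 1) • (D ^ (r + 1)) (P.adj ⟨r, hr⟩ i J₀ 1) := by
    intro r
    induction r with
    | zero =>
      intro hr
      have h1 := P.adj_recursion F hJ ⟨0, hr⟩ i
      rw [dif_pos rfl, zero_add] at h1
      rw [sum_eq_single ⟨0, hr⟩ (fun s _ hs => if_neg fun h0 => hs (Fin.ext (Nat.le_zero.1 h0)))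
        (by simp)]
      simp only [le_refl, if_true, pow_zero, one_smul, Module.End.one_apply, zero_add, pow_one,
        neg_one_smul]
      exact eq_neg_of_add_eq_zero_right h1
    | succ r ih =>
      intro hr
      have h1 := P.adj_recursion F hJ ⟨r + 1, hr⟩ i
      rw [dif_neg (Nat.succ_ne_zero r)] at h1
      have h2 : G ⟨r + 1, hr⟩ = -(D (P.adj ⟨r + 1, hr⟩ i J₀ 1) +
          P.adj ⟨r, (Nat.lt_succ_self r).trans hr⟩ i J₀ 1) := by
        rw [← add_assoc] at h1
        exact eq_neg_of_add_eq_zero_right h1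
      have h3 : ∀ s : Fin h, (if (s : ℕ) ≤ r + 1 then
          (-1 : ℝ) ^ (s : ℕ) • (D ^ (s : ℕ)) (G s) else 0) =
          (if (s : ℕ) ≤ r then (-1 : ℝ) ^ (s : ℕ) • (D ^ (s : ℕ)) (G s) else 0) +
          if s = ⟨r + 1, hr⟩ then
            (-1 : ℝ) ^ (r + 1) • (D ^ (r + 1)) (G ⟨r + 1, hr⟩) else 0 := by
        intro s
        by_cases hs : s = ⟨r + 1, hr⟩
        · subst hs
          simp
        · have : (s : ℕ) ≠ r + 1 := fun h => hs (Fin.ext h)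
          have h4 : (s : ℕ) ≤ r + 1 ↔ (s : ℕ) ≤ r := by omega
          simp [hs, h4]
      rw [sum_congr rfl fun s _ => h3 s, sum_add_distrib, ih ((Nat.lt_succ_self r).trans hr),
        sum_ite_eq' univ, if_pos (mem_univ _), h2, map_neg, map_add, pow_succ D (r + 1),
        Module.End.mul_apply, smul_neg, smul_add, pow_succ (-1 : ℝ) (r + 1), mul_neg_one, neg_smul]
      abel
  have hpos := NeZero.pos h
  have h1 := key (h - 1) (by omega)
  rw [Nat.sub_add_cancel hpos] at h1
  simp only [hDi]
  refine h1.symm.trans (sum_congr rfl fun s _ => ?_)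
  rw [if_pos (by omega)]

/-- The coefficient at `D_x^K` of the adjoint linearized operator. -/
def opCoeffX (i k : Fin m) (K : Fin n →₀ ℕ) : R :=
  (∑ᶠ L : Fin n →₀ ℕ, ((-1) ^ (K + L).degree * multichoose K L) •
    P.dxI L (P.d (.u 0 i (K + L)) (F k))) +
  if K = 0 then ∑ s : Fin h, if s = 0 then 0 else
    (-1 : ℝ) ^ (s : ℕ) • (P.dt F)^[s] (P.d (.u s i 0) (F k)) else 0

/-- The coefficient at `D_t^r` of the adjoint linearized operator. -/
def opCoeffT (i k : Fin m) (r : Fin h) : R :=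
  ∑ s : Fin h, if r ≤ s then ((-1 : ℝ) ^ (s : ℕ) * ((s : ℕ).choose (r : ℕ) : ℝ)) •
    (P.dt F)^[(s : ℕ) - (r : ℕ)] (P.d (.u s i 0) (F k)) else 0

/-- The term without derivatives of `g` is kept apart because in `L` it is merged into the
coefficient at `D_x^0`. -/
theorem sum_dt_mul (a : Fin h → R) (g : R) :
    (∑ s : Fin h, if s = 0 then 0 else (-1 : ℝ) ^ (s : ℕ) • (P.dt F)^[s] (a s * g)) =
      (∑ s : Fin h, if s = 0 then 0 else (-1 : ℝ) ^ (s : ℕ) • (P.dt F)^[s] (a s)) * g +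
      ∑ r : Fin h, if r = 0 then 0 else
        (∑ s : Fin h, if r ≤ s then ((-1 : ℝ) ^ (s : ℕ) * ((s : ℕ).choose (r : ℕ) : ℝ)) •
          (P.dt F)^[(s : ℕ) - (r : ℕ)] (a s) else 0) * (P.dt F)^[r] g := by
  have h1 : ∀ s : Fin h, (P.dt F)^[s] (a s * g) = (P.dt F)^[s] (a s) * g +
      ∑ r : Fin h, if r = 0 then 0 else if r ≤ s then
        ((s : ℕ).choose (r : ℕ) : ℝ) • ((P.dt F)^[(s : ℕ) - (r : ℕ)] (a s) * (P.dt F)^[r] g)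
        else 0 := by
    intro s
    have h2 : (P.dt F)^[s] (a s * g) = ∑ r : Fin h, if r ≤ s then
        ((s : ℕ).choose (r : ℕ) : ℝ) • ((P.dt F)^[(s : ℕ) - (r : ℕ)] (a s) * (P.dt F)^[r] g)
        else 0 := by
      rw [Derivation.iterate_apply_mul]
      have := Fin.sum_univ_eq_sum_range (fun r => if r ≤ (s : ℕ) then
        ((s : ℕ).choose r : ℝ) • ((P.dt F)^[(s : ℕ) - r] (a s) * (P.dt F)^[r] g) else 0) h
      simp only [Fin.le_def]
      rw [this, ← sum_filter]
      refine sum_congr ?_ fun r _ => ?_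
      · ext r
        have := s.2
        simp only [mem_range, mem_filter]
        omega
      · rw [Nat.cast_smul_eq_nsmul, nsmul_eq_mul, mul_assoc]
    rw [h2, ← add_sum_erase _ _ (mem_univ (0 : Fin h))]
    congr 1
    · simp
    · rw [← add_sum_erase univ (fun r : Fin h => if r = 0 then (0 : R) else _) (mem_univ 0),
        if_pos rfl, zero_add]
      exact sum_congr rfl fun r hr => by rw [if_neg (ne_of_mem_erase hr)]
  simp only [h1, sum_mul]
  rw [← sub_eq_iff_eq_add', ← sum_sub_distrib]
  have h3 : ∀ s : Fin h, ((if s = 0 then 0 else (-1 : ℝ) ^ (s : ℕ) • ((P.dt F)^[s] (a s) * g +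
      ∑ r : Fin h, if r = 0 then 0 else if r ≤ s then
        ((s : ℕ).choose (r : ℕ) : ℝ) • ((P.dt F)^[(s : ℕ) - (r : ℕ)] (a s) * (P.dt F)^[r] g)
        else 0)) - (if s = 0 then 0 else (-1 : ℝ) ^ (s : ℕ) • (P.dt F)^[s] (a s)) * g) =
      ∑ r : Fin h, if r = 0 then 0 else (if r ≤ s then
        ((-1 : ℝ) ^ (s : ℕ) * ((s : ℕ).choose (r : ℕ) : ℝ)) •
          (P.dt F)^[(s : ℕ) - (r : ℕ)] (a s) else 0) * (P.dt F)^[r] g := by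
    intro s
    by_cases hs : s = 0
    · subst hs
      rw [if_pos rfl, if_pos rfl, zero_mul, sub_zero]
      refine (sum_eq_zero fun r _ => ?_).symm
      split_ifs with h₁ h₂
      · rfl
      · exact absurd (le_antisymm h₂ (Fin.zero_le _)) h₁
      · exact zero_mul _
    · rw [if_neg hs, if_neg hs, smul_add, smul_mul_assoc, add_sub_cancel_left, smul_sum]
      refine sum_congr rfl fun r _ => ?_
      split_ifs <;> simp [mul_smul]
  rw [sum_congr rfl fun s _ => h3 s, sum_comm]
  refine sum_congr rfl fun r _ => ?_
  split_ifs
  · simp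
  · rfl

/-- The Leibniz rule splits each `I` as `K + L`, where `D_x^K` falls on `g`; the terms are regrouped
by `K`. Since `T` is closed under taking such parts, it can index both `K` and `L`. -/
theorem adj_zero_eq_sum (T : Finset (Fin n →₀ ℕ)) (i k : Fin m)
    (hT : ∀ I ∉ T, P.d (.u 0 i I) (F k) = 0) (hdown : ∀ K L, K + L ∈ T → K ∈ T ∧ L ∈ T)
    (g : R) :
    P.adj 0 i (F k) g = ∑ K ∈ T, (∑ᶠ L : Fin n →₀ ℕ, ((-1) ^ (K + L).degree * multichoose K L) •
      P.dxI L (P.d (.u 0 i (K + L)) (F k))) * P.dxI K g := by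
  set Φ : (Fin n →₀ ℕ) × (Fin n →₀ ℕ) → R := fun p =>
    ((-1 : ℝ) ^ (p.1 + p.2).degree * multichoose p.1 p.2) •
      P.dxI p.2 (P.d (.u 0 i (p.1 + p.2)) (F k)) * P.dxI p.1 g with hΦ
  have h1 : P.adj 0 i (F k) g = ∑ I ∈ T, ∑ p ∈ antidiagonal I, Φ p := by
    rw [P.adj_apply_eq_sum 0 i _ g T hT]
    refine sum_congr rfl fun I _ => ?_
    rw [dxI_mul_apply, smul_sum]
    refine sum_congr rfl fun p hp => ?_
    rw [HasAntidiagonal.mem_antidiagonal] at hp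
    rw [hΦ]
    simp only
    rw [hp, smul_mul_assoc, mul_smul]
  have h2 : ∀ K ∈ T, (∑ᶠ L : Fin n →₀ ℕ, ((-1) ^ (K + L).degree * multichoose K L) •
      P.dxI L (P.d (.u 0 i (K + L)) (F k))) * P.dxI K g = ∑ L ∈ T, Φ (K, L) := by
    intro K _
    rw [finsum_eq_sum_of_support_subset (s := T), sum_mul]
    intro L hL
    by_contra h
    refine hL ?_
    simp only
    rw [hT _ fun h' => h (hdown _ _ h').2, map_zero, smul_zero]
  rw [h1, sum_congr rfl h2, ← sum_product']
  have h3 : ∑ p ∈ T ×ˢ T, Φ p = ∑ p ∈ T ×ˢ T with p.1 + p.2 ∈ T, Φ p := by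
    refine (sum_filter_of_ne fun p _ hp => ?_).symm
    by_contra h
    refine hp ?_
    rw [hΦ]
    simp only
    rw [hT _ h, map_zero, smul_zero, zero_mul]
  rw [h3, ← sum_fiberwise_of_maps_to (t := T) 
    (g := fun p : (Fin n →₀ ℕ) × (Fin n →₀ ℕ) => p.1 + p.2) fun p hp => (mem_filter.1 hp).2]
  refine sum_congr rfl fun I hI => sum_congr ?_ fun _ _ => rfl
  ext p
  simp only [HasAntidiagonal.mem_antidiagonal, mem_filter, mem_product]
  constructor
  · intro h
    exact ⟨⟨hdown _ _ (h ▸ hI), h ▸ hI⟩, h⟩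
  · exact fun h => h.2

/-- The adjoint linearized equation for the characteristic, with the operator expanded by the
Leibniz rule. -/
theorem adjoint_equation_expanded {J₀ : R} {J : Fin n → R}
    (hJ : P.dt F J₀ + ∑ j, P.dx j (J j) = 0)
    (hF : ∀ k (s : Fin h) i I, s ≠ 0 → I ≠ 0 → P.d (.u s i I) (F k) = 0)
    (T : Finset (Fin n →₀ ℕ)) (hT : ∀ k i, ∀ I ∉ T, P.d (.u 0 i I) (F k) = 0)
    (hdown : ∀ K L, K + L ∈ T → K ∈ T ∧ L ∈ T) (hT0 : 0 ∈ T)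
    (χ : Fin m → R) (hχ : ∀ i, χ i = P.adj (lastTime h) i J₀ 1) (i : Fin m) :
    (-1 : ℝ) ^ h • (P.dt F)^[h] (χ i) =
      ∑ k, ((∑ K ∈ T, P.opCoeffX F i k K * P.dxI K (χ k)) +
        ∑ r : Fin h, if r = 0 then 0 else P.opCoeffT F i k r * (P.dt F)^[r] (χ k)) := by
  have h1 : ∀ k, ∑ s : Fin h, (-1 : ℝ) ^ (s : ℕ) • (P.dt F)^[s] (P.adj s i (F k) (χ k)) =
      (∑ K ∈ T, P.opCoeffX F i k K * P.dxI K (χ k)) +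
        ∑ r : Fin h, if r = 0 then 0 else P.opCoeffT F i k r * (P.dt F)^[r] (χ k) := by
    intro k
    have h2 := P.sum_dt_mul F (fun s => P.d (.u s i 0) (F k)) (χ k)
    -- For `s ≠ 0` only the pure time derivative `u_{s,0}` occurs in `F`, so the adjoint is a
    -- multiplication.
    have h3 : ∑ s : Fin h, (-1 : ℝ) ^ (s : ℕ) • (P.dt F)^[s] (P.adj s i (F k) (χ k)) =
        P.adj 0 i (F k) (χ k) + ∑ s : Fin h, if s = 0 then 0 else
          (-1 : ℝ) ^ (s : ℕ) • (P.dt F)^[s] (P.d (.u s i 0) (F k) * χ k) := by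
      rw [← add_sum_erase _ _ (mem_univ (0 : Fin h)),
        ← add_sum_erase univ (fun s : Fin h => if s = 0 then (0 : R) else _) (mem_univ 0),
        if_pos rfl, zero_add]
      congr 1
      · simp
      · refine sum_congr rfl fun s hs => ?_
        have hs0 := ne_of_mem_erase hs
        rw [if_neg hs0, P.adj_apply_single s i _ _ fun I hI => hF k s i I hs0 hI]
    rw [h3, h2, ← add_assoc, P.adj_zero_eq_sum F T i k (hT k i) hdown]
    congr 1
    simp only [opCoeffX, add_mul, sum_add_distrib]
    congr 1
    rw [sum_eq_single_of_mem 0 hT0 fun K _ hK => by rw [if_neg hK, zero_mul], if_pos rfl]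
    simp
  rw [hχ, P.adjoint_equation F hJ i, ← sum_congr rfl fun k _ => h1 k, sum_comm]
  refine sum_congr rfl fun s _ => ?_
  rw [← smul_sum]
  congr 1
  simp only [← hχ]
  have := map_sum ((P.dt F : Module.End ℝ R) ^ (s : ℕ)) (fun k => P.adj s i (F k) (χ k)) univ
  simpa only [Module.End.pow_apply, Derivation.coeFn_coe] using this

end Adjoint

end Partials

end GenEvol

end

/-! ### Top-order coefficients of the adjoint equation. -/

noncomputable section

namespace GenEvol

namespace Partials

open Finset

variable {n m h : ℕ} {R : Type*} [CommRing R] [Algebra ℝ R] (P : Partials (Coord n m h) R)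

section Dx

variable {s : Fin h} {i : Fin m} {f : R} {a : ℕ}

theorem d_dx_eq_zero (hf : ∀ I : Fin n →₀ ℕ, a < I.degree → P.d (.u s i I) f = 0) (j : Fin n)
    (I : Fin n →₀ ℕ) (hI : a + 1 < I.degree) : P.d (.u s i I) (P.dx j f) = 0 := by
  by_cases h0 : I j = 0
  · rw [d_dx_of_eq_zero _ _ _ _ _ h0, hf I (by omega), map_zero]
  · obtain ⟨I, rfl⟩ : ∃ I', I = I' + Finsupp.single j 1 :=
      ⟨_, (tsub_add_cancel_of_le (Finsupp.single_le_iff.2 (Nat.one_le_iff_ne_zero.2 h0))).symm⟩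
    rw [map_add, Finsupp.degree_single] at hI
    rw [d_dx_add_single, hf _ (by rw [map_add]; omega), hf _ (by omega), map_zero, add_zero]

theorem d_dxI_eq_zero (hf : ∀ I : Fin n →₀ ℕ, a < I.degree → P.d (.u s i I) f = 0)
    (J I : Fin n →₀ ℕ) (hI : a + J.degree < I.degree) : P.d (.u s i I) (P.dxI J f) = 0 := by
  induction J using Finsupp.induction_add_single generalizing I with
  | zero => simpa using hf I (by simpa using hI)
  | add_single J j ih =>
    rw [dxI_add_single_apply]
    rw [map_add, Finsupp.degree_single] at hI
    exact P.d_dx_eq_zero ih j I (by omega)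

/-- At top order a total derivative acts only by the shift `u_K ↦ u_{K+1_j}`, so the leading
variables of `D_x^J f` have the form `u_{K+J}`; `d_dxI_add` gives their coefficients. -/
theorem d_dxI_of_not_le (hf : ∀ I : Fin n →₀ ℕ, a < I.degree → P.d (.u s i I) f = 0)
    (J I : Fin n →₀ ℕ) (hI : I.degree = a + J.degree) (hle : ¬ J ≤ I) :
    P.d (.u s i I) (P.dxI J f) = 0 := by
  induction J using Finsupp.induction_add_single generalizing I with
  | zero => exact absurd zero_le hle
  | add_single J j ih =>
    rw [dxI_add_single_apply]
    rw [map_add, Finsupp.degree_single] at hI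
    have hz := P.d_dxI_eq_zero hf J I (by omega)
    by_cases h0 : I j = 0
    · rw [d_dx_of_eq_zero _ _ _ _ _ h0, hz, map_zero]
    · obtain ⟨I, rfl⟩ : ∃ I', I = I' + Finsupp.single j 1 :=
        ⟨_, (tsub_add_cancel_of_le (Finsupp.single_le_iff.2 (Nat.one_le_iff_ne_zero.2 h0))).symm⟩
      rw [map_add, Finsupp.degree_single] at hI
      rw [d_dx_add_single, hz, map_zero, zero_add]
      exact ih I (by omega) fun h => hle (add_le_add_left h _)

theorem d_dxI_add (hf : ∀ I : Fin n →₀ ℕ, a < I.degree → P.d (.u s i I) f = 0)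
    (J K : Fin n →₀ ℕ) (hK : K.degree = a) :
    P.d (.u s i (K + J)) (P.dxI J f) = P.d (.u s i K) f := by
  induction J using Finsupp.induction_add_single with
  | zero => simp
  | add_single J j ih =>
    rw [dxI_add_single_apply, ← add_assoc, d_dx_add_single, ih,
      P.d_dxI_eq_zero hf J _ (by simp [hK]), map_zero, zero_add]

/-- A sum over multi-indices whose terms vanish unless they are bounded by `I`. -/
theorem _root_.Finset.sum_antidiagonal_fst_eq_finsum {M : Type*} [AddCommMonoid M]
    (I : Fin n →₀ ℕ) (φ : (Fin n →₀ ℕ) → M) (hφ : ∀ J, ¬ J ≤ I → φ J = 0) :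
    ∑ᶠ J, φ J = ∑ p ∈ antidiagonal I, φ p.1 := by
  have hinj : Set.InjOn (fun p : (Fin n →₀ ℕ) × (Fin n →₀ ℕ) => p.1)
      (antidiagonal I : Finset _) := by
    intro p hp q hq hpq
    rw [mem_coe, HasAntidiagonal.mem_antidiagonal] at hp hq
    have hpq' : p.1 = q.1 := hpq
    refine Prod.ext hpq' (add_left_cancel (a := p.1) ?_)
    rw [hp, hpq', hq]
  rw [← sum_image hinj]
  refine finsum_eq_sum_of_support_subset _ fun J hJ => ?_
  have hle : J ≤ I := by
    by_contra h
    exact hJ (hφ J h)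
  rw [mem_coe, mem_image]
  exact ⟨(J, I - J), by simp [add_tsub_cancel_of_le hle], rfl⟩

end Dx

/-- The system has space order at most `N` in the `u_0`, and no mixed derivatives on the
right-hand sides. -/
structure HasOrderLE (F : Fin m → R) (N : ℕ) : Prop where
  mixed : ∀ k (s : Fin h) i (I : Fin n →₀ ℕ), (s : ℕ) ≠ 0 → I ≠ 0 → P.d (.u s i I) (F k) = 0
  space : ∀ k (s : Fin h) i (I : Fin n →₀ ℕ), (s : ℕ) = 0 → N < I.degree →
    P.d (.u s i I) (F k) = 0

section Dt

variable {P} {F : Fin m → R} {N : ℕ}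

theorem HasOrderLE.d_dxI_space (hF : P.HasOrderLE F N) (k i : Fin m) (s : Fin h)
    (hs : (s : ℕ) = 0) (J I : Fin n →₀ ℕ) (hI : N + J.degree < I.degree) :
    P.d (.u s i I) (P.dxI J (F k)) = 0 :=
  P.d_dxI_eq_zero (fun K hK => hF.space k s i K hs hK) J I hI

theorem HasOrderLE.d_dxI_mixed (hF : P.HasOrderLE F N) (k i : Fin m) (s : Fin h)
    (hs : (s : ℕ) ≠ 0) (J I : Fin n →₀ ℕ) (hI : J.degree < I.degree) :
    P.d (.u s i I) (P.dxI J (F k)) = 0 :=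
  P.d_dxI_eq_zero (a := 0) (fun K hK => hF.mixed k s i K hs fun h => by simp [h] at hK) J I
    (by omega)

/-- The coordinates `u_{s,I}` on which the `r`-th time derivative of a function may depend if the
function has space order `M` and time order `τ`. -/
def TimeBound (h M N τ r s a : ℕ) : Prop :=
  a < M ∨ (a = M ∧ s ≤ τ + r) ∨ (s < r ∧ a < M + N) ∨ (a = M + N ∧ s + h ≤ τ + r)

/-- A time step moves `u_{s,I}` to `u_{s+1,I}`, and `u_{h-1,J}` to `D_x^J F`, which involves
`u_{0,I}` with `|I| ≤ |J| + N` and the other `u_{s,I}` with `|I| ≤ |J|`. For `r < h` the bound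
admits `u_{h-1,J}` only with `|J| ≤ M`, so the jump by `N` cannot happen twice. -/
theorem d_dt_eq_zero (hF : P.HasOrderLE F N) {M τ r : ℕ} (hN : 0 < N) (hτ : τ < h) (hr : r < h)
    {g : R} (hg : ∀ (s : Fin h) i (I : Fin n →₀ ℕ),
      ¬ TimeBound h M N τ r s I.degree → P.d (.u s i I) g = 0)
    (s : Fin h) (i : Fin m) (I : Fin n →₀ ℕ) (hI : ¬ TimeBound h M N τ (r + 1) s I.degree) :
    P.d (.u s i I) (P.dt F g) = 0 := by
  rw [dt, d_vf, hg s i I fun h => hI (by unfold TimeBound at *; omega), map_zero, zero_add]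
  refine P.vf_eq_zero fun e => ?_
  cases e with
  | t => simp [dtCoeff]
  | x j => simp [dtCoeff]
  | u s' k J =>
    by_cases hV : TimeBound h M N τ r s' J.degree
    · left
      rw [dtCoeff]
      split_ifs with hs'
      · refine P.d_coord_of_ne fun heq => ?_
        simp only [Coord.u.injEq] at heq
        obtain ⟨rfl, rfl, rfl⟩ := heq
        refine hI ?_
        simp only
        unfold TimeBound at *
        omega
      · have := s'.2
        by_cases hs : (s : ℕ) = 0
        · refine hF.d_dxI_space k i s hs J I ?_
          unfold TimeBound at *
          omega
        · refine hF.d_dxI_mixed k i s hs J I ?_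
          have := s.2
          unfold TimeBound at *
          omega
    · exact Or.inr (hg s' k J hV)

theorem d_dt_iterate_eq_zero (hF : P.HasOrderLE F N) {M τ : ℕ} (hN : 0 < N) (hτ : τ < h)
    {f : R} (hf : ∀ (s : Fin h) i (I : Fin n →₀ ℕ),
      M < I.degree ∨ I.degree = M ∧ τ < s → P.d (.u s i I) f = 0) {r : ℕ} (hr : r ≤ h)
    (s : Fin h) (i : Fin m) (I : Fin n →₀ ℕ) (hI : ¬ TimeBound h M N τ r s I.degree) :
    P.d (.u s i I) ((P.dt F)^[r] f) = 0 := by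
  induction r generalizing s i I with
  | zero =>
    refine hf s i I ?_
    unfold TimeBound at hI
    omega
  | succ r ih =>
    rw [Function.iterate_succ_apply']
    exact d_dt_eq_zero hF hN hτ (by omega) (ih (by omega)) s i I hI

/-- The derivative `∂/∂u_{s+1,I}` of a time derivative, if it only comes from `u_{s,I}`. -/
theorem d_succ_dt (hF : P.HasOrderLE F N) {g : R} {s : ℕ} (hs : s + 1 < h) (i : Fin m)
    (I : Fin n →₀ ℕ) (hg : P.d (.u ⟨s + 1, hs⟩ i I) g = 0)
    (hlast : ∀ (s' : Fin h) k (J : Fin n →₀ ℕ), (s' : ℕ) + 1 = h → I.degree ≤ J.degree →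
      P.d (.u s' k J) g = 0) :
    P.d (.u ⟨s + 1, hs⟩ i I) (P.dt F g) = P.d (.u ⟨s, by omega⟩ i I) g := by
  rw [dt, d_vf, hg, map_zero, zero_add, vf_apply, finsum_eq_single _ (.u ⟨s, by omega⟩ i I)]
  · rw [dtCoeff, dif_pos hs, d_coord_self, one_mul]
  · intro e he
    cases e with
    | t => simp [dtCoeff]
    | x j => simp [dtCoeff]
    | u s' k J =>
      rw [dtCoeff]
      split_ifs with hs'
      · rw [d_coord_of_ne, zero_mul]
        intro heq
        simp only [Coord.u.injEq, Fin.mk.injEq, add_left_inj] at heq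
        obtain ⟨h1, rfl, rfl⟩ := heq
        exact he (by simp only [Coord.u.injEq, and_true]; exact Fin.ext h1.symm)
      · by_cases hJ : I.degree ≤ J.degree
        · rw [hlast s' k J (by have := s'.2; omega) hJ, mul_zero]
        · rw [hF.d_dxI_mixed k i _ (Nat.succ_ne_zero s) J I (by omega), zero_mul]

/-- The derivative `∂/∂u_{0,I}` of a time derivative, if it only comes from `u_{h-1,J}` with
`|J| + N ≤ |I|`. -/
theorem d_zero_dt [NeZero h] (hF : P.HasOrderLE F N) {g : R} {M : ℕ} (i : Fin m)
    (I : Fin n →₀ ℕ) (hI : I.degree = M + N) (hg : P.d (.u 0 i I) g = 0)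
    (hlast : ∀ k (J : Fin n →₀ ℕ), M < J.degree → P.d (.u (lastTime h) k J) g = 0) :
    P.d (.u 0 i I) (P.dt F g) =
      ∑ k, ∑ p ∈ antidiagonal I, P.d (.u (lastTime h) k p.1) g * P.d (.u 0 i p.2) (F k) := by
  have hfin : (Function.support fun e => P.d (.u 0 i I) (P.dtCoeff F e) * P.d e g).Finite :=
    (P.finite g).subset fun e he h => he (by simp only; rw [h, mul_zero])
  rw [dt, d_vf, hg, map_zero, zero_add, vf_apply, Coord.finsum_eq _ hfin,
    finsum_triple _ (hfin.preimage Coord.u_injective.injOn), sum_eq_single (lastTime h)]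
  · simp only [dtCoeff, Derivation.map_one_eq_zero, map_zero, zero_mul, sum_const_zero, zero_add]
    refine sum_congr rfl fun k _ => ?_
    have hl : ¬ ((lastTime h : Fin h) : ℕ) + 1 < h := by
      have := NeZero.pos h
      simp only [lastTime]
      omega
    simp only [dif_neg hl]
    have hF0 : ∀ J : Fin n →₀ ℕ, N < J.degree → P.d (.u 0 i J) (F k) = 0 := fun J hJ =>
      hF.space k 0 i J rfl hJ
    rw [Finset.sum_antidiagonal_fst_eq_finsum I]
    · refine sum_congr rfl fun p hp => ?_
      rw [HasAntidiagonal.mem_antidiagonal] at hp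
      have hdeg : p.1.degree + p.2.degree = M + N := by rw [← map_add, hp, hI]
      rw [mul_comm]
      rcases lt_trichotomy p.1.degree M with hlt | heq | hgt
      · rw [hF0 p.2 (by omega), P.d_dxI_eq_zero hF0 _ _ (by omega)]
      · rw [← hp, add_comm, P.d_dxI_add hF0 _ _ (by omega)]
      · rw [hlast _ _ hgt, zero_mul, zero_mul]
    · intro J hJ
      by_cases hd : M < J.degree
      · rw [hlast _ _ hd, mul_zero]
      · by_cases hd' : J.degree = M
        · rw [P.d_dxI_of_not_le hF0 _ _ (by omega) hJ, zero_mul]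
        · rw [P.d_dxI_eq_zero hF0 _ _ (by omega), zero_mul]
  · intro s' _ hs'
    refine sum_eq_zero fun k _ => finsum_eq_zero_of_forall_eq_zero fun J => ?_
    have hl : (s' : ℕ) + 1 < h := by
      have h3 : (s' : ℕ) ≠ h - 1 := fun h => hs' (Fin.ext h)
      have := s'.2
      omega
    simp only [dtCoeff, dif_pos hl]
    rw [d_coord_of_ne, zero_mul]
    intro heq
    simp only [Coord.u.injEq] at heq
    have := congrArg Fin.val heq.1
    simp at this
  · simp

variable [NeZero h]

/-- The top coefficients of the `h`-th time derivative. -/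
theorem d_dt_iterate_top (hF : P.HasOrderLE F N) {M : ℕ} {τ : Fin h} (hN : 0 < N)
    {f : R} (hf : ∀ (s : Fin h) i (I : Fin n →₀ ℕ),
      M < I.degree ∨ I.degree = M ∧ τ < s → P.d (.u s i I) f = 0)
    (i : Fin m) (I : Fin n →₀ ℕ) (hI : I.degree = M + N) :
    P.d (.u τ i I) ((P.dt F)^[h] f) =
      ∑ k, ∑ p ∈ antidiagonal I, P.d (.u τ k p.1) f * P.d (.u 0 i p.2) (F k) := by
  have hτ := τ.2
  have hzero : ∀ {r : ℕ}, r ≤ h → ∀ (s : Fin h) (i : Fin m) (I : Fin n →₀ ℕ),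
      ¬ TimeBound h M N τ r s I.degree → P.d (.u s i I) ((P.dt F)^[r] f) = 0 := fun hr =>
    d_dt_iterate_eq_zero hF hN hτ hf hr
  -- The first `h - 1 - τ` steps carry the leading coefficients unchanged from time index `τ` to `h
  -- - 1`.
  have h1 : ∀ r (hr : τ + r < h) (k : Fin m) (J : Fin n →₀ ℕ), J.degree = M →
      P.d (.u ⟨τ + r, hr⟩ k J) ((P.dt F)^[r] f) = P.d (.u τ k J) f := by
    intro r
    induction r with
    | zero => exact fun hr k J hJ => rfl
    | succ r ih =>
      intro hr k J hJ
      rw [Function.iterate_succ_apply', ← ih (by omega) k J hJ]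
      refine d_succ_dt hF hr k J (hzero (by omega) _ _ _ ?_) fun s' k' J' hs' hJ' =>
        hzero (by omega) _ _ _ ?_
      · simp only [TimeBound, Nat.add_eq]
        omega
      · simp only [TimeBound]
        omega
  -- The next step passes from `u_{h-1}` to `u_0`; it alone raises the order by `N` and brings in
  -- the derivatives of `F`.
  have h2 : P.d (.u 0 i I) ((P.dt F)^[h - τ] f) =
      ∑ k, ∑ p ∈ antidiagonal I, P.d (.u τ k p.1) f * P.d (.u 0 i p.2) (F k) := by
    have hlast : ((lastTime h : Fin h) : ℕ) = h - 1 := rfl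
    rw [show h - (τ : ℕ) = (h - 1 - τ) + 1 by omega, Function.iterate_succ_apply',
      d_zero_dt hF (M := M) i I hI (hzero (by omega) _ _ _ ?_) fun k J hJ =>
        hzero (by omega) _ _ _ ?_]
    · refine sum_congr rfl fun k _ => sum_congr rfl fun p hp => ?_
      rw [HasAntidiagonal.mem_antidiagonal] at hp
      have hdeg : p.1.degree + p.2.degree = M + N := by rw [← map_add, hp, hI]
      by_cases hp1 : p.1.degree = M
      · rw [← h1 (h - 1 - τ) (by omega) k p.1 hp1]
        have : lastTime h = ⟨τ + (h - 1 - τ), by omega⟩ :=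
          Fin.ext (by rw [hlast]; simp only; omega)
        rw [this]
      · by_cases hp2 : M < p.1.degree
        · rw [hf τ k p.1 (Or.inl hp2), zero_mul, hzero (by omega), zero_mul]
          simp only [TimeBound, hlast]
          omega
        · rw [hF.space k 0 i p.2 rfl (by omega), mul_zero, mul_zero]
    · simp only [TimeBound, Fin.val_zero]
      omega
    · simp only [TimeBound, hlast]
      omega
  -- The remaining `τ` steps climb from `u_0` to `u_τ` at order `M + N`, for a total of `h` steps.
  have h3 : ∀ (s : ℕ) (hs : s ≤ (τ : ℕ)), P.d (.u ⟨s, by omega⟩ i I) ((P.dt F)^[h - τ + s] f) =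
      ∑ k, ∑ p ∈ antidiagonal I, P.d (.u τ k p.1) f * P.d (.u 0 i p.2) (F k) := by
    intro s
    induction s with
    | zero => exact fun _ => h2
    | succ s ih =>
      intro hs
      rw [← add_assoc, Function.iterate_succ_apply', ← ih (by omega)]
      refine d_succ_dt hF (by omega) i I (hzero (by omega) _ _ _ ?_) fun s' k' J' hs' hJ' =>
        hzero (by omega) _ _ _ ?_
      · simp only [TimeBound]
        omega
      · simp only [TimeBound]
        omega
  have h4 := h3 τ le_rfl
  rwa [Nat.sub_add_cancel hτ.le] at h4

/-- A term with `L ≠ 0` contains `∂F/∂u_{0,K+L}` with `|K + L| > N`, which is zero; `N > 0` excludes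
the additional terms at `K = 0`. -/
theorem opCoeffX_top (hF : P.HasOrderLE F N) (hN : 0 < N) (i k : Fin m) (K : Fin n →₀ ℕ)
    (hK : K.degree = N) :
    P.opCoeffX F i k K = (-1 : ℝ) ^ N • P.d (.u 0 i K) (F k) := by
  have hK0 : K ≠ 0 := by
    rintro rfl
    simp at hK
    omega
  rw [opCoeffX, if_neg hK0, add_zero, finsum_eq_single _ 0]
  · simp [multichoose_zero_right, hK]
  · intro L hL
    have : L.degree ≠ 0 := fun h => hL ((Finsupp.degree_eq_zero_iff L).1 h)
    rw [hF.space k 0 i _ rfl (by rw [map_add]; omega), map_zero, smul_zero]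

theorem opCoeffX_eq_zero (hF : P.HasOrderLE F N) (i k : Fin m) (K : Fin n →₀ ℕ)
    (hK : N < K.degree) : P.opCoeffX F i k K = 0 := by
  have hK0 : K ≠ 0 := by
    rintro rfl
    simp at hK
  rw [opCoeffX, if_neg hK0, add_zero]
  refine finsum_eq_zero_of_forall_eq_zero fun L => ?_
  rw [hF.space k 0 i _ rfl (by rw [map_add]; omega), map_zero, smul_zero]

/-- Comparison of the top coefficients in the adjoint linearized equation. -/
theorem symbol_identity (hF : P.HasOrderLE F N) (hN : 0 < N) {J₀ : R} {J : Fin n → R}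
    (hJ : P.dt F J₀ + ∑ j, P.dx j (J j) = 0)
    (χ : Fin m → R) (hχ : ∀ i, χ i = P.adj (lastTime h) i J₀ 1) {M : ℕ} {τ : Fin h}
    (hf : ∀ k (s : Fin h) i (I : Fin n →₀ ℕ),
      M < I.degree ∨ I.degree = M ∧ τ < s → P.d (.u s i I) (χ k) = 0)
    (hX : ∀ i k K (s : Fin h) j (I : Fin n →₀ ℕ), M + N ≤ I.degree →
      P.d (.u s j I) (P.opCoeffX F i k K) = 0)
    (hT : ∀ i k (r : Fin h), r ≠ 0 → ∀ (s : Fin h) j (I : Fin n →₀ ℕ), M + N ≤ I.degree →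
      P.d (.u s j I) (P.opCoeffT F i k r) = 0)
    (i j : Fin m) (I : Fin n →₀ ℕ) (hI : I.degree = M + N) :
    (-1 : ℝ) ^ h • ∑ k, ∑ p ∈ antidiagonal I,
        P.d (.u τ k p.1) (χ i) * P.d (.u 0 j p.2) (F k) =
      (-1 : ℝ) ^ N • ∑ k, ∑ p ∈ antidiagonal I,
        P.d (.u 0 i p.1) (F k) * P.d (.u τ j p.2) (χ k) := by
  classical
  set T : Finset (Fin n →₀ ℕ) := (range (N + 1)).biUnion fun a => finsuppAntidiag univ a with hTdef
  have hmem : ∀ K : Fin n →₀ ℕ, K ∈ T ↔ K.degree ≤ N := by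
    intro K
    rw [hTdef]
    simp only [mem_biUnion, mem_range, mem_finsuppAntidiag, subset_univ, and_true]
    rw [Finsupp.degree_eq_sum]
    have hsum : univ.sum ⇑K = ∑ i, K i := rfl
    constructor
    · rintro ⟨a, ha, rfl⟩
      omega
    · exact fun hK => ⟨_, by omega, rfl⟩
  have hF0 : ∀ k i (K : Fin n →₀ ℕ), N < K.degree → P.d (.u 0 i K) (F k) = 0 := fun k i K hK =>
    hF.space k 0 i K rfl hK
  have heq := P.adjoint_equation_expanded F hJ
    (fun k s i I hs hI => hF.mixed k s i I (fun h => hs (Fin.ext h)) hI) T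
    (fun k i I hI => hF0 k i I (by rw [hmem] at hI; omega))
    (fun K L hKL => by simp only [hmem, map_add] at hKL ⊢; omega)
    (by rw [hmem]; simp) χ hχ i
  have heq' := congrArg (P.d (.u τ j I)) heq
  rw [Derivation.map_smul, d_dt_iterate_top hF hN (hf i) j I hI] at heq'
  rw [heq', map_sum, smul_sum]
  refine sum_congr rfl fun k _ => ?_
  -- Neither factor depends on `u_{τ,I}`: the coefficient by `hT`, and `D_t^r χ` because fewer than
  -- `h` steps do not reach time index `τ` at order `M + N`.
  have hTsum : P.d (.u τ j I) (∑ r : Fin h, if r = 0 then 0 else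
      P.opCoeffT F i k r * (P.dt F)^[r] (χ k)) = 0 := by
    rw [map_sum]
    refine sum_eq_zero fun r _ => ?_
    split_ifs with hr
    · exact map_zero _
    · rw [Derivation.leibniz, hT i k r hr τ j I hI.ge, smul_zero, add_zero,
        d_dt_iterate_eq_zero hF hN τ.2 (hf k) r.2.le, smul_zero]
      have := r.2
      simp only [TimeBound]
      omega
  rw [map_add, hTsum, add_zero, map_sum]
  have hχ0 : ∀ K : Fin n →₀ ℕ, M < K.degree → P.d (.u τ j K) (χ k) = 0 := fun K hK =>
    hf k τ j K (Or.inl hK)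
  have hterm : ∀ K, P.d (.u τ j I) (P.opCoeffX F i k K * P.dxI K (χ k)) =
      P.opCoeffX F i k K * P.d (.u τ j I) (P.dxI K (χ k)) := by
    intro K
    rw [Derivation.leibniz, hX i k K τ j I hI.ge, smul_zero, add_zero, smul_eq_mul]
  rw [sum_congr rfl fun K _ => hterm K, ← finsum_eq_sum_of_support_subset,
    Finset.sum_antidiagonal_fst_eq_finsum I, smul_sum]
  · refine sum_congr rfl fun p hp => ?_
    rw [HasAntidiagonal.mem_antidiagonal] at hp
    have hdeg : p.1.degree + p.2.degree = M + N := by rw [← map_add, hp, hI]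
    -- If `|K| < N`, then `D_x^K χ` has order below `M + N`; if `|K| > N`, the coefficient is zero.
    rcases lt_trichotomy p.1.degree N with hlt | hN' | hgt
    · rw [hχ0 p.2 (by omega), P.d_dxI_eq_zero hχ0 _ _ (by omega), mul_zero, mul_zero, smul_zero]
    · rw [opCoeffX_top hF hN _ _ _ hN', ← hp, add_comm p.1, P.d_dxI_add hχ0 _ _ (by omega),
        smul_mul_assoc]
    · rw [opCoeffX_eq_zero hF _ _ _ hgt, hF0 _ _ _ hgt, zero_mul, zero_mul, smul_zero]
  · intro K hK
    rcases lt_trichotomy K.degree N with hlt | hN' | hgt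
    · rw [P.d_dxI_eq_zero hχ0 _ _ (by omega), mul_zero]
    · rw [P.d_dxI_of_not_le hχ0 _ _ (by omega) hK, mul_zero]
    · rw [opCoeffX_eq_zero hF _ _ _ hgt, zero_mul]
  · intro K hK
    rw [mem_coe, hmem]
    by_contra h
    exact hK (by simp only; rw [opCoeffX_eq_zero hF _ _ _ (by omega), zero_mul])

end Dt

end Partials

end GenEvol

end

/-! ### Smooth functions of finitely many coordinates as a ring with partial derivatives. -/

noncomputable section

namespace GenEvol

variable {n m h : ℕ}

/-- Restriction of a point to the coordinates in `T`. -/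
def proj (T : Finset (Coord n m h)) (p : Jet n m h) : T → ℝ := fun c => p c

open Classical in
/-- The image in `T → ℝ` of the direction of the coordinate `c`. -/
def dir (T : Finset (Coord n m h)) (c : Coord n m h) : T → ℝ :=
  fun c' => if (c' : Coord n m h) = c then 1 else 0

/-- Freezing the coordinates outside `T` at a point of `U` gives a continuous local section of the
projection. Openness turns smoothness on the image into smoothness at each of its points. -/
theorem isOpen_proj_image {U : Set (Jet n m h)} (hU : IsOpen U) (T : Finset (Coord n m h)) :
    IsOpen (proj T '' U) := by
  classical
  rw [isOpen_iff_mem_nhds]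
  rintro _ ⟨p, hp, rfl⟩
  set σ : (T → ℝ) → Jet n m h := fun y c => if hc : c ∈ T then y ⟨c, hc⟩ else p c with hσ
  have hσc : Continuous σ := by
    refine continuous_pi fun c => ?_
    by_cases hc : c ∈ T
    · simpa [hσ, hc] using continuous_apply (⟨c, hc⟩ : T)
    · simpa [hσ, hc] using continuous_const
  have hσp : σ (proj T p) = p := by
    funext c
    by_cases hc : c ∈ T <;> simp [hσ, hc, proj]
  refine Filter.mem_of_superset ((hU.preimage hσc).mem_nhds (by rwa [Set.mem_preimage, hσp])) ?_
  intro y hy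
  refine ⟨σ y, hy, ?_⟩
  funext c
  simp [proj, hσ]

/-- `f` agrees on `U` with the smooth function `g` of the coordinates in `T`. -/
def Represents (U : Set (Jet n m h)) (T : Finset (Coord n m h)) (g : (T → ℝ) → ℝ)
    (f : JetFun n m h) : Prop :=
  ContDiffOn ℝ ∞ g (proj T '' U) ∧ ∀ p ∈ U, f p = g (proj T p)

theorem isSmoothIn_univ_iff {U : Set (Jet n m h)} {f : JetFun n m h} :
    IsSmoothIn Set.univ U f ↔ ∃ T g, Represents U T g f := by
  constructor
  · rintro ⟨T, -, g, h₁, h₂⟩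
    exact ⟨T, g, h₁, h₂⟩
  · rintro ⟨T, g, h₁, h₂⟩
    exact ⟨T, Set.subset_univ _, g, h₁, h₂⟩

theorem IsSmoothIn.to_univ {V : Set (Coord n m h)} {U : Set (Jet n m h)} {f : JetFun n m h}
    (hf : IsSmoothIn V U f) : IsSmoothIn Set.univ U f := by
  obtain ⟨T, -, g, h₁, h₂⟩ := hf
  exact ⟨T, Set.subset_univ _, g, h₁, h₂⟩

/-- Lets two functions be represented over one common set of coordinates. -/
theorem Represents.mono {U : Set (Jet n m h)} {T T' : Finset (Coord n m h)} {g : (T → ℝ) → ℝ}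
    {f : JetFun n m h} (hf : Represents U T g f) (hT : T ⊆ T') :
    ∃ g', Represents U T' g' f := by
  refine ⟨fun y => g fun c => y ⟨c, hT c.2⟩, hf.1.comp (t := proj T '' U) ?_ ?_, hf.2⟩
  · exact ContDiff.contDiffOn (contDiff_pi.2 fun c => contDiff_apply _ _ _)
  · rintro _ ⟨p, hp, rfl⟩
    exact ⟨p, hp, rfl⟩

theorem exists_represents₂ {U : Set (Jet n m h)} {f f' : JetFun n m h}
    (hf : IsSmoothIn Set.univ U f) (hf' : IsSmoothIn Set.univ U f') :
    ∃ T g g', Represents U T g f ∧ Represents U T g' f' := by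
  classical
  obtain ⟨T, g, hg⟩ := isSmoothIn_univ_iff.1 hf
  obtain ⟨T', g', hg'⟩ := isSmoothIn_univ_iff.1 hf'
  obtain ⟨k, hk⟩ := hg.mono (T' := T ∪ T') Finset.subset_union_left
  obtain ⟨k', hk'⟩ := hg'.mono (T' := T ∪ T') Finset.subset_union_right
  exact ⟨_, k, k', hk, hk'⟩

section Calculus

variable {U : Set (Jet n m h)} {T : Finset (Coord n m h)} {g : (T → ℝ) → ℝ} {f : JetFun n m h}

theorem Represents.contDiffAt (hU : IsOpen U) (hf : Represents U T g f) {p : Jet n m h}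
    (hp : p ∈ U) : ContDiffAt ℝ ∞ g (proj T p) :=
  hf.1.contDiffAt ((isOpen_proj_image hU T).mem_nhds ⟨p, hp, rfl⟩)

open Classical in
theorem eventually_update_mem (hU : IsOpen U) {p : Jet n m h} (hp : p ∈ U) (c : Coord n m h) :
    ∀ᶠ r in nhds (p c), Function.update p c r ∈ U := by
  have hc : Continuous fun r : ℝ => Function.update p c r := continuous_const.update c continuous_id
  refine hc.continuousAt.eventually_mem (hU.mem_nhds ?_)
  rwa [Function.update_eq_self]

open Classical in
theorem Represents.hasDerivAt (hU : IsOpen U) (hf : Represents U T g f) {p : Jet n m h}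
    (hp : p ∈ U) (c : Coord n m h) :
    HasDerivAt (fun r : ℝ => f (Function.update p c r)) (fderiv ℝ g (proj T p) (dir T c))
      (p c) := by
  have h1 : HasDerivAt (fun r : ℝ => proj T (Function.update p c r)) (dir T c) (p c) := by
    rw [hasDerivAt_pi]
    intro c'
    by_cases hc : (c' : Coord n m h) = c
    · subst hc
      simp only [proj, dir, Function.update_self, if_true]
      exact hasDerivAt_id _
    · simpa [proj, dir, hc] using hasDerivAt_const (p c) (p c')
  have h2 : DifferentiableAt ℝ g (proj T (Function.update p c (p c))) := by
    rw [Function.update_eq_self]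
    exact (hf.contDiffAt hU hp).differentiableAt (by simp)
  have h3 := h2.hasFDerivAt.comp_hasDerivAt (p c) h1
  rw [Function.update_eq_self] at h3
  refine h3.congr_of_eventuallyEq ?_
  filter_upwards [eventually_update_mem hU hp c] with r hr
  exact hf.2 _ hr

theorem Represents.pd_apply (hU : IsOpen U) (hf : Represents U T g f) {p : Jet n m h}
    (hp : p ∈ U) (c : Coord n m h) : pd c f p = fderiv ℝ g (proj T p) (dir T c) :=
  (hf.hasDerivAt hU hp c).deriv

theorem Represents.pd (hU : IsOpen U) (hf : Represents U T g f) (c : Coord n m h) :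
    Represents U T (fun y => fderiv ℝ g y (dir T c)) (pd c f) :=
  ⟨(hf.1.fderiv_of_isOpen (isOpen_proj_image hU T) (by simp)).clm_apply contDiffOn_const,
    fun _ hp => hf.pd_apply hU hp c⟩

/-- Symmetry of the second Fréchet derivative of the representing function. -/
theorem Represents.pd_comm (hU : IsOpen U) (hf : Represents U T g f) {p : Jet n m h}
    (hp : p ∈ U) (a b : Coord n m h) :
    GenEvol.pd a (GenEvol.pd b f) p = GenEvol.pd b (GenEvol.pd a f) p := by
  have hg := hf.contDiffAt hU hp
  have hd : DifferentiableAt ℝ (fderiv ℝ g) (proj T p) :=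
    (hg.fderiv_right (m := 1) (by norm_cast)).differentiableAt (by simp)
  have h1 : ∀ v w : T → ℝ, fderiv ℝ (fun y => fderiv ℝ g y v) (proj T p) w =
      fderiv ℝ (fderiv ℝ g) (proj T p) w v := by
    intro v w
    rw [fderiv_clm_apply hd (differentiableAt_const v)]
    simp
  rw [(hf.pd hU b).pd_apply hU hp a, (hf.pd hU a).pd_apply hU hp b, h1, h1]
  exact (hg.isSymmSndFDerivAt (by simp; norm_cast)).eq _ _

theorem pd_add_apply (hU : IsOpen U) {f f' : JetFun n m h} (hf : IsSmoothIn Set.univ U f)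
    (hf' : IsSmoothIn Set.univ U f') {p : Jet n m h} (hp : p ∈ U) (c : Coord n m h) :
    pd c (fun q => f q + f' q) p = pd c f p + pd c f' p := by
  obtain ⟨T, g, g', hg, hg'⟩ := exists_represents₂ hf hf'
  rw [hg.pd_apply hU hp, hg'.pd_apply hU hp]
  exact ((hg.hasDerivAt hU hp c).add (hg'.hasDerivAt hU hp c)).deriv

theorem pd_mul_apply (hU : IsOpen U) {f f' : JetFun n m h} (hf : IsSmoothIn Set.univ U f)
    (hf' : IsSmoothIn Set.univ U f') {p : Jet n m h} (hp : p ∈ U) (c : Coord n m h) :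
    pd c (fun q => f q * f' q) p = f p * pd c f' p + f' p * pd c f p := by
  classical
  obtain ⟨T, g, g', hg, hg'⟩ := exists_represents₂ hf hf'
  rw [hg.pd_apply hU hp, hg'.pd_apply hU hp]
  have h1 := ((hg.hasDerivAt hU hp c).mul (hg'.hasDerivAt hU hp c)).deriv
  simp only [Function.update_eq_self] at h1
  refine Eq.trans ?_ (h1.trans ?_)
  · unfold pd
    congr!
  · ring

/-- A small change of one coordinate stays in the open set `U`, so values outside `U` do not matter.
This makes the extension by zero used below harmless. -/
theorem pd_congr (hU : IsOpen U) {f f' : JetFun n m h} (hff : ∀ p ∈ U, f p = f' p)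
    {p : Jet n m h} (hp : p ∈ U) (c : Coord n m h) : pd c f p = pd c f' p := by
  classical
  refine Filter.EventuallyEq.deriv_eq ?_
  filter_upwards [eventually_update_mem hU hp c] with r hr
  exact hff _ hr

end Calculus

/-- The algebra of smooth functions of finitely many coordinates on `U`. -/
def smoothAlgebra (U : Set (Jet n m h)) : Subalgebra ℝ (U → ℝ) where
  carrier := {f | IsSmoothIn Set.univ U (Function.extend Subtype.val f 0)}
  mul_mem' {f f'} hf hf' := by
    obtain ⟨T, g, g', hg, hg'⟩ := exists_represents₂ hf hf'
    refine isSmoothIn_univ_iff.2 ⟨T, fun y => g y * g' y, hg.1.mul hg'.1, fun p hp => ?_⟩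
    have h₁ := hg.2 p hp
    have h₂ := hg'.2 p hp
    lift p to U using hp
    rw [Subtype.val_injective.extend_apply] at *
    rw [Pi.mul_apply, h₁, h₂]
  add_mem' {f f'} hf hf' := by
    obtain ⟨T, g, g', hg, hg'⟩ := exists_represents₂ hf hf'
    refine isSmoothIn_univ_iff.2 ⟨T, fun y => g y + g' y, hg.1.add hg'.1, fun p hp => ?_⟩
    have h₁ := hg.2 p hp
    have h₂ := hg'.2 p hp
    lift p to U using hp
    rw [Subtype.val_injective.extend_apply] at *
    rw [Pi.add_apply, h₁, h₂]
  algebraMap_mem' r := by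
    refine isSmoothIn_univ_iff.2 ⟨∅, fun _ => r, contDiffOn_const, fun p hp => ?_⟩
    lift p to U using hp
    rw [Subtype.val_injective.extend_apply]
    rfl

section Ring

variable {U : Set (Jet n m h)}

theorem isSmoothIn_extend (a : smoothAlgebra U) :
    IsSmoothIn Set.univ U (Function.extend Subtype.val (a : U → ℝ) 0) := a.2

/-- The function `f` restricts to the element `a` of the ring of smooth functions on `U`. -/
def Rep (f : JetFun n m h) (a : smoothAlgebra U) : Prop := ∀ p : U, f p = (a : U → ℝ) p

theorem rep_extend (a : smoothAlgebra U) : Rep (Function.extend Subtype.val (a : U → ℝ) 0) a :=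
  fun p => Subtype.val_injective.extend_apply _ _ p

theorem IsSmoothIn.exists_rep {V : Set (Coord n m h)} {f : JetFun n m h} (hf : IsSmoothIn V U f) :
    ∃ a : smoothAlgebra U, Rep f a := by
  obtain ⟨T, g, h₁, h₂⟩ := isSmoothIn_univ_iff.1 hf.to_univ
  refine ⟨⟨fun p => f p, isSmoothIn_univ_iff.2 ⟨T, g, h₁, fun p hp => ?_⟩⟩, fun p => rfl⟩
  rw [← h₂ p hp]
  lift p to U using hp
  exact Subtype.val_injective.extend_apply _ _ p

variable (hU : IsOpen U)

/-- The partial derivatives on the ring of smooth functions on `U`. -/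
def pdRing (c : Coord n m h) (a : smoothAlgebra U) : smoothAlgebra U :=
  ⟨fun p => pd c (Function.extend Subtype.val (a : U → ℝ) 0) p, by
    obtain ⟨T, g, hg⟩ := isSmoothIn_univ_iff.1 (isSmoothIn_extend a)
    refine isSmoothIn_univ_iff.2 ⟨T, _, (hg.pd hU c).1, fun p hp => ?_⟩
    refine Eq.trans ?_ ((hg.pd hU c).2 p hp)
    lift p to U using hp
    exact Subtype.val_injective.extend_apply _ _ p⟩

theorem Rep.pdRing {f : JetFun n m h} {a : smoothAlgebra U} (hf : Rep f a) (c : Coord n m h) :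
    Rep (pd c f) (pdRing hU c a) := fun p =>
  pd_congr hU (fun q hq => by
    lift q to U using hq
    rw [hf q, Subtype.val_injective.extend_apply]) p.2 c

theorem pdRing_add (c : Coord n m h) (a b : smoothAlgebra U) :
    pdRing hU c (a + b) = pdRing hU c a + pdRing hU c b := by
  ext p
  have h1 : Rep (fun q => Function.extend Subtype.val (a : U → ℝ) 0 q +
      Function.extend Subtype.val (b : U → ℝ) 0 q) (a + b) := fun p =>
    congrArg₂ (· + ·) (rep_extend a p) (rep_extend b p)
  rw [← h1.pdRing hU c p, pd_add_apply hU (isSmoothIn_extend a) (isSmoothIn_extend b) p.2]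
  rfl

theorem pdRing_mul (c : Coord n m h) (a b : smoothAlgebra U) :
    pdRing hU c (a * b) = a * pdRing hU c b + b * pdRing hU c a := by
  ext p
  have h1 : Rep (fun q => Function.extend Subtype.val (a : U → ℝ) 0 q *
      Function.extend Subtype.val (b : U → ℝ) 0 q) (a * b) := fun p =>
    congrArg₂ (· * ·) (rep_extend a p) (rep_extend b p)
  rw [← h1.pdRing hU c p, pd_mul_apply hU (isSmoothIn_extend a) (isSmoothIn_extend b) p.2,
    rep_extend a p, rep_extend b p]
  rfl

theorem pdRing_algebraMap (c : Coord n m h) (r : ℝ) :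
    pdRing hU c (algebraMap ℝ (smoothAlgebra U) r) = 0 := by
  ext p
  have h1 : Rep (fun _ => r) (algebraMap ℝ (smoothAlgebra U) r) := fun p => rfl
  rw [← h1.pdRing hU c p]
  exact deriv_const _ _

/-- The coordinate functions on `U`. -/
def coordRing (U : Set (Jet n m h)) (c : Coord n m h) : smoothAlgebra U :=
  ⟨fun p => (p : Jet n m h) c, by
    refine isSmoothIn_univ_iff.2 ⟨{c}, fun y => y ⟨c, by simp⟩,
      (contDiff_apply _ _ _).contDiffOn, fun p hp => ?_⟩
    lift p to U using hp
    exact Subtype.val_injective.extend_apply _ _ p⟩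

theorem rep_coordRing (c : Coord n m h) : Rep (fun p => p c) (coordRing U c) := fun _ => rfl

/-- The partial derivatives on the ring of smooth functions on an open set `U`. -/
def jetPartials : Partials (Coord n m h) (smoothAlgebra U) where
  d c := Derivation.mk'
    { toFun := pdRing hU c
      map_add' := pdRing_add hU c
      map_smul' := fun r a => by
        rw [Algebra.smul_def, pdRing_mul, pdRing_algebraMap, mul_zero, add_zero,
          RingHom.id_apply, Algebra.smul_def] }
    (pdRing_mul hU c)
  coord := coordRing U
  comm a b f := by
    ext p
    obtain ⟨T, g, hg⟩ := isSmoothIn_univ_iff.1 (isSmoothIn_extend f)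
    have h1 := (((rep_extend f).pdRing hU b).pdRing hU a) p
    have h2 := (((rep_extend f).pdRing hU a).pdRing hU b) p
    exact h1.symm.trans ((hg.pd_comm hU p.2 a b).trans h2)
  -- Only the coordinates in a representing set `T` can contribute, since the others have direction
  -- zero in `T → ℝ`.
  finite f := by
    obtain ⟨T, g, hg⟩ := isSmoothIn_univ_iff.1 (isSmoothIn_extend f)
    refine T.finite_toSet.subset fun c hc => ?_
    by_contra hcT
    refine hc ?_
    ext p
    refine (hg.pd_apply hU p.2 c).trans ?_
    have h0 : dir T c = 0 := by
      funext c'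
      have : (c' : Coord n m h) ≠ c := fun h => hcT (h ▸ c'.2)
      simp [dir, this]
    rw [h0, map_zero]
    rfl
  d_coord_self c := by
    classical
    ext p
    refine ((rep_coordRing c).pdRing hU c p).symm.trans ?_
    simp [pd]
  d_coord_of_ne {c c'} hc := by
    classical
    ext p
    refine ((rep_coordRing c').pdRing hU c p).symm.trans ?_
    simp [pd, Function.update_of_ne hc.symm]

theorem Rep.d {f : JetFun n m h} {a : smoothAlgebra U} (hf : Rep f a) (c : Coord n m h) :
    Rep (pd c f) ((jetPartials hU).d c a) := hf.pdRing hU c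

end Ring

end GenEvol

end

/-! ### Transfer between functions on the jet space and ring elements; orders. -/

noncomputable section

namespace GenEvol

variable {n m h : ℕ} {U : Set (Jet n m h)}

/-- Evaluation at a point of `U`. -/
def evalAt (p : U) : smoothAlgebra U →+* ℝ :=
  (Pi.evalRingHom (fun _ : U => ℝ) p).comp (smoothAlgebra U).val.toRingHom

theorem evalAt_apply (p : U) (a : smoothAlgebra U) : evalAt p a = (a : U → ℝ) p := rfl

section Rep

variable {f f' : JetFun n m h} {a a' : smoothAlgebra U}

theorem Rep.add (hf : Rep f a) (hf' : Rep f' a') : Rep (fun p => f p + f' p) (a + a') := fun p =>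
  congrArg₂ (· + ·) (hf p) (hf' p)

theorem Rep.const_mul (r : ℝ) (hf : Rep f a) : Rep (fun p => r * f p) (r • a) := fun p =>
  congrArg (r * ·) (hf p)

theorem rep_zero : Rep (fun _ => 0) (0 : smoothAlgebra U) := fun _ => rfl

theorem Rep.sum {ι : Type*} {φ : ι → JetFun n m h} {α : ι → smoothAlgebra U} (T : Finset ι)
    (hφ : ∀ i, Rep (φ i) (α i)) : Rep (fun p => ∑ i ∈ T, φ i p) (∑ i ∈ T, α i) := fun p => by
  rw [← evalAt_apply, map_sum]
  exact Finset.sum_congr rfl fun i _ => hφ i p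

theorem Rep.finsum {ι : Type*} {φ : ι → JetFun n m h} {α : ι → smoothAlgebra U}
    (hφ : ∀ i, Rep (φ i) (α i)) (hα : (Function.support α).Finite) :
    Rep (fun p => ∑ᶠ i, φ i p) (∑ᶠ i, α i) := fun p => by
  have := (evalAt p).toAddMonoidHom.map_finsum hα
  refine (finsum_congr fun i => hφ i p).trans this.symm

variable (hU : IsOpen U)

/-- Splits the sum over coordinates into the shape used by `Dx` and `Dt`. -/
theorem vf_eval (b : Coord n m h → smoothAlgebra U) (a : smoothAlgebra U) (p : U) :
    ((jetPartials hU).vf b a : U → ℝ) p =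
      (b .t : U → ℝ) p * ((jetPartials hU).d .t a : U → ℝ) p +
      ∑ j, (b (.x j) : U → ℝ) p * ((jetPartials hU).d (.x j) a : U → ℝ) p +
      ∑ᶠ c : Fin h × Fin m × (Fin n →₀ ℕ), (b (.u c.1 c.2.1 c.2.2) : U → ℝ) p *
        ((jetPartials hU).d (.u c.1 c.2.1 c.2.2) a : U → ℝ) p := by
  have hfin : (Function.support fun c => b c * (jetPartials hU).d c a).Finite :=
    ((jetPartials hU).finite a).subset fun c hc h => hc (by simp only; rw [h, mul_zero])
  rw [Partials.vf_apply, Coord.finsum_eq _ hfin, ← evalAt_apply, map_add, map_add, map_sum]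
  congr 1
  exact (evalAt p).toAddMonoidHom.map_finsum (hfin.preimage Coord.u_injective.injOn)

theorem Rep.dx (hf : Rep f a) (j : Fin n) : Rep (Dx j f) ((jetPartials hU).dx j a) := fun p => by
  rw [Partials.dx, vf_eval, Dx]
  congr 1
  · rw [Finset.sum_eq_single j]
    · simp only [Partials.dxCoeff, if_true]
      rw [hf.d hU _ p]
      simp
    · intro j' _ hj'
      simp [Partials.dxCoeff, hj']
    · simp
  · exact finsum_congr fun c => congrArg₂ (· * ·) rfl (hf.d hU _ p)

theorem Rep.iterate {D : JetFun n m h → JetFun n m h} {E : smoothAlgebra U → smoothAlgebra U}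
    (hD : ∀ {f a}, Rep f a → Rep (D f) (E a)) (hf : Rep f a) (k : ℕ) :
    Rep (D^[k] f) (E^[k] a) := by
  induction k with
  | zero => exact hf
  | succ k ih =>
    rw [Function.iterate_succ_apply', Function.iterate_succ_apply']
    exact hD ih

theorem Rep.dxI (hf : Rep f a) (I : Fin n →₀ ℕ) : Rep (DxI I f) ((jetPartials hU).dxI I a) := by
  rw [DxI, Partials.dxI]
  induction List.finRange n with
  | nil => exact hf
  | cons j l ih =>
    rw [List.foldr_cons, List.map_cons, List.prod_cons, Module.End.mul_apply,
      Module.End.pow_apply]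
    exact ih.iterate (fun hf => hf.dx hU j) _

variable {F : Fin m → JetFun n m h} {α : Fin m → smoothAlgebra U} (hF : ∀ i, Rep (F i) (α i))

include hF

theorem Rep.dt (hf : Rep f a) : Rep (Dt F f) ((jetPartials hU).dt α a) := fun p => by
  rw [Partials.dt, vf_eval, Dt]
  congr 1
  · simp only [Partials.dtCoeff]
    rw [hf.d hU _ p]
    simp
  · refine finsum_congr fun c => congrArg₂ (· * ·) ?_ (hf.d hU _ p)
    rw [Partials.dtCoeff]
    split_ifs
    · rfl
    · exact (hF _).dxI hU _ p

theorem Rep.coeffT (i k : Fin m) (r : Fin h) :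
    Rep (coeffT F i k r) ((jetPartials hU).opCoeffT α i k r) := by
  refine Rep.sum _ fun s => ?_
  split_ifs
  · exact ((((hF k).d hU _).iterate (fun hf => hf.dt hU hF) _)).const_mul _
  · exact rep_zero

variable [NeZero h]

omit hF in
theorem Rep.characteristic (hf : Rep f a) (i : Fin m) :
    Rep (characteristic f i) ((jetPartials hU).adj (lastTime h) i a 1) := by
  rw [Partials.adj_apply]
  refine Rep.finsum (fun I => ?_) ?_
  · rw [mul_one]
    exact ((hf.d hU _).dxI hU I).const_mul _
  · refine ((jetPartials hU).finite_u (lastTime h) i a).subset fun I hI h => hI ?_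
    simp only
    rw [h, zero_mul, map_zero, smul_zero]

theorem Rep.coeffX (i k : Fin m) (K : Fin n →₀ ℕ) :
    Rep (coeffX F i k K) ((jetPartials hU).opCoeffX α i k K) := by
  refine Rep.add (Rep.finsum (fun L => ?_) ?_) ?_
  · exact (((hF k).d hU _).dxI hU L).const_mul _
  · refine (((jetPartials hU).finite_u 0 i (α k)).preimage
      (add_right_injective K).injOn).subset fun L hL h => hL ?_
    simp only
    rw [h, map_zero, smul_zero]
  · split_ifs
    · refine Rep.sum _ fun s => ?_
      split_ifs
      · exact rep_zero
      · exact ((((hF k).d hU _).iterate (fun hf => hf.dt hU hF) _)).const_mul _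
    · exact rep_zero

end Rep

section Order

variable (hU : IsOpen U) {ι : Type*} {f : ι → JetFun n m h} {α : ι → smoothAlgebra U}

theorem Rep.pd_ne_zero_iff {f : JetFun n m h} {a : smoothAlgebra U} (hf : Rep f a)
    (c : Coord n m h) : (∃ p ∈ U, pd c f p ≠ 0) ↔ (jetPartials hU).d c a ≠ 0 := by
  constructor
  · rintro ⟨p, hp, hne⟩ h0
    lift p to U using hp
    refine hne ?_
    rw [hf.d hU c p, h0]
    rfl
  · intro hne
    by_contra! hcon
    refine hne ?_
    ext p
    rw [← hf.d hU c p, hcon p p.2]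
    rfl

variable (hf : ∀ i, Rep (f i) (α i))

include hU hf

/-- The integer `sSup` has a default value on unbounded sets; finiteness makes `order` a genuine
maximum. -/
theorem finite_order_set [Finite ι] : {d : ℤ | ∃ s i I, d = ((I : Fin n →₀ ℕ).degree : ℤ) ∧
    ∃ a, ∃ p ∈ U, pd (Coord.u s i I) (f a) p ≠ 0}.Finite := by
  have h1 : ({I : Fin n →₀ ℕ | ∃ s i a, (jetPartials hU).d (.u s i I) (α a) ≠ 0}).Finite := by
    have : {I : Fin n →₀ ℕ | ∃ s i a, (jetPartials hU).d (.u s i I) (α a) ≠ 0} =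
        ⋃ s, ⋃ i, ⋃ a, {I : Fin n →₀ ℕ | (jetPartials hU).d (.u s i I) (α a) ≠ 0} := by
      ext I
      simp
    rw [this]
    exact Set.finite_iUnion fun s => Set.finite_iUnion fun i => Set.finite_iUnion fun a =>
      (jetPartials hU).finite_u s i (α a)
  refine (h1.image fun I => (I.degree : ℤ)).subset ?_
  rintro d ⟨s, i, I, rfl, a, hp⟩
  exact ⟨I, ⟨s, i, a, ((hf a).pd_ne_zero_iff hU _).1 hp⟩, rfl⟩

theorem d_eq_zero_of_order_lt [Finite ι] {I : Fin n →₀ ℕ} (hI : order U f < I.degree)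
    (s : Fin h) (i : Fin m) (a : ι) : (jetPartials hU).d (.u s i I) (α a) = 0 := by
  by_contra hne
  refine hI.not_ge (le_csSup ((finite_order_set hU hf).insert _).bddAbove ?_)
  exact Set.mem_insert_of_mem _ ⟨s, i, I, rfl, a, ((hf a).pd_ne_zero_iff hU _).2 hne⟩

theorem order_eq_neg_one (h0 : ∀ i, α i = 0) : order U f = -1 := by
  have : {d : ℤ | ∃ s i I, d = ((I : Fin n →₀ ℕ).degree : ℤ) ∧
      ∃ a, ∃ p ∈ U, pd (Coord.u s i I) (f a) p ≠ 0} = ∅ := by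
    rw [Set.eq_empty_iff_forall_notMem]
    rintro d ⟨s, i, I, -, a, hp⟩
    exact ((hf a).pd_ne_zero_iff hU _).1 hp (by rw [h0, map_zero])
  rw [order, this, insert_empty_eq, csSup_singleton]

theorem d_eq_zero_of_timeOrder_lt [NeZero h] {I : Fin n →₀ ℕ} (hI : (I.degree : ℤ) = order U f)
    {s : Fin h} (hs : timeOrder U f < s) (i : Fin m) (a : ι) :
    (jetPartials hU).d (.u s i I) (α a) = 0 := by
  classical
  by_contra hne
  refine hs.not_ge ?_
  rw [timeOrder]
  refine Finset.le_sup (f := id) (Finset.mem_filter.2 ⟨Finset.mem_univ s, i, I, hI, a, ?_⟩)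
  exact ((hf a).pd_ne_zero_iff hU _).2 hne

end Order

end GenEvol

end

/-! ### The symbol identity. -/

noncomputable section

namespace GenEvol

open Finset

variable {n m h : ℕ} {U : Set (Jet n m h)}

theorem coeff_symbolAt {ι : Type*} (hU : IsOpen U) {f : ι → JetFun n m h}
    {α : ι → smoothAlgebra U} (hf : ∀ i, Rep (f i) (α i)) (a : ℕ) (b : Fin h) (i : ι) (j : Fin m)
    (K : Fin n →₀ ℕ) :
    (symbolAt U a b f i j).coeff K =
      if K.degree = a then ((jetPartials hU).d (.u b j K) (α i) : U → ℝ) else 0 := by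
  classical
  have hd : (fun p : U => pd (Coord.u b j K) (f i) p) =
      ((jetPartials hU).d (.u b j K) (α i) : U → ℝ) := funext fun p => (hf i).d hU _ p
  have hmem : K ∈ finsuppAntidiag univ a ↔ K.degree = a := by
    rw [mem_finsuppAntidiag, Finsupp.degree_eq_sum]
    exact and_iff_left (subset_univ _)
  simp only [symbolAt, MvPolynomial.coeff_sum, MvPolynomial.coeff_monomial]
  rw [sum_ite_eq', hd]
  simp only [hmem]

/-- Right-hand sides that depend on the admissible coordinates only. -/
theorem hasOrderLE_of_isSmoothIn {F : Fin m → JetFun n m h} (hU : IsOpen U) (hF : ∀ i, IsSmoothIn (admissible n m h) U (F i))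
    {α : Fin m → smoothAlgebra U} (hα : ∀ i, Rep (F i) (α i)) {N : ℕ} (hN : order U F = N) :
    (jetPartials hU).HasOrderLE α N where
  mixed k s i I hs hI := by
    obtain ⟨T, hT, g, h₁, h₂⟩ := hF k
    have hg : Represents U T g (F k) := ⟨h₁, h₂⟩
    ext p
    rw [← (hα k).d hU _ p, hg.pd_apply hU p.2]
    have h0 : dir T (Coord.u s i I) = 0 := by
      funext c
      have : (c : Coord n m h) ≠ Coord.u s i I := fun hc =>
        (hT c.2 s i I hc).elim hs hI
      simp [dir, this]
    rw [h0, map_zero]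
    rfl
  space k s i I _ hI := d_eq_zero_of_order_lt hU hα (by rw [hN]; exact_mod_cast hI) s i k

variable [NeZero h] {F : Fin m → JetFun n m h}

section OrderBound

variable (hU : IsOpen U) {α : Fin m → smoothAlgebra U} (hF : ∀ i, Rep (F i) (α i)) {N : ℕ}
  (hα : (jetPartials hU).HasOrderLE α N)

include hU hF hα

/-- Infinitely many `K` occur, but those with `|K| > N` have zero coefficient and all give the value
`-1 - order U F`. Hence `orderBound` is a genuine maximum. -/
theorem finite_orderBound_set :
    ({d : ℤ | ∃ i j K, d = order U (fun _ : Unit => coeffX F i j K) - order U F} ∪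
      {d : ℤ | ∃ i j r, r ≠ 0 ∧ d = order U (fun _ : Unit => coeffT F i j r) - order U F}).Finite := by
  have hfin : {K : Fin n →₀ ℕ | K.degree ≤ N}.Finite := by
    refine ((range (N + 1)).biUnion fun a =>
      finsuppAntidiag (univ : Finset (Fin n)) a).finite_toSet.subset fun K hK => ?_
    rw [mem_coe, mem_biUnion]
    refine ⟨K.degree, mem_range.2 (Nat.lt_succ_of_le hK), ?_⟩
    rw [mem_finsuppAntidiag, Finsupp.degree_eq_sum]
    exact ⟨rfl, subset_univ _⟩
  refine Set.Finite.union ?_ ?_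
  · refine (((Set.finite_univ (α := Fin m × Fin m)).prod hfin).image (fun c =>
      order U (fun _ : Unit => coeffX F c.1.1 c.1.2 c.2) - order U F)).union
        (Set.finite_singleton (-1 - order U F)) |>.subset ?_
    rintro d ⟨i, j, K, rfl⟩
    by_cases hK : K.degree ≤ N
    · exact Or.inl ⟨((i, j), K), ⟨Set.mem_univ _, hK⟩, rfl⟩
    · right
      rw [Set.mem_singleton_iff, order_eq_neg_one hU (fun _ => Rep.coeffX hU hF i j K)]
      exact fun _ => Partials.opCoeffX_eq_zero hα i j K (by omega)
  · refine (Set.finite_range fun c : Fin m × Fin m × Fin h =>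
      order U (fun _ : Unit => coeffT F c.1 c.2.1 c.2.2) - order U F).subset ?_
    rintro d ⟨i, j, r, -, rfl⟩
    exact ⟨(i, j, r), rfl⟩

theorem neg_one_le_orderBound : -1 ≤ orderBound U F :=
  le_csSup ((finite_orderBound_set hU hF hα).insert _).bddAbove (Set.mem_insert _ _)

theorem order_coeffX_le (i j : Fin m) (K : Fin n →₀ ℕ) :
    order U (fun _ : Unit => coeffX F i j K) - order U F ≤ orderBound U F :=
  le_csSup ((finite_orderBound_set hU hF hα).insert _).bddAbove
    (Set.mem_insert_of_mem _ (Or.inl ⟨i, j, K, rfl⟩))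

theorem order_coeffT_le (i j : Fin m) (r : Fin h) (hr : r ≠ 0) :
    order U (fun _ : Unit => coeffT F i j r) - order U F ≤ orderBound U F :=
  le_csSup ((finite_orderBound_set hU hF hα).insert _).bddAbove
    (Set.mem_insert_of_mem _ (Or.inr ⟨i, j, r, hr, rfl⟩))

end OrderBound

/-- Mixed derivatives are absent from `F`, so at positive space order only the `u_{0,I}` occur. -/
theorem timeOrder_eq_zero (hU : IsOpen U) {α : Fin m → smoothAlgebra U}
    (hF : ∀ i, Rep (F i) (α i)) {N : ℕ} (hα : (jetPartials hU).HasOrderLE α N)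
    (hN : 0 < order U F) : timeOrder U F = 0 := by
  classical
  rw [timeOrder]
  refine le_antisymm (Finset.sup_le fun s hs => ?_) (Fin.zero_le _)
  obtain ⟨i, I, hI, a, hp⟩ := (mem_filter.1 hs).2
  by_contra hs0
  replace hs0 : s ≠ 0 := fun h => hs0 h.le
  refine ((hF a).pd_ne_zero_iff hU _).1 hp (hα.mixed a s i I (fun h => hs0 (Fin.ext h)) ?_)
  rintro rfl
  simp at hI
  omega

/-- The symbols of the system and of the characteristic anticommute up to transposition. -/
theorem symbol_mul_symbol (hU : IsOpen U) (hF : ∀ i, IsSmoothIn (admissible n m h) U (F i))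
    (hN : 0 < order U F) (hodd : Odd (order U F + h))
    {J₀ : JetFun n m h} {J : Fin n → JetFun n m h} (hJ : IsConservedCurrent U F J₀ J)
    (hord : orderBound U F < order U (characteristic J₀)) :
    symbol U (characteristic J₀) * symbol U F =
      -((symbol U F).transpose * symbol U (characteristic J₀)) := by
  choose α hα using fun i => (hF i).exists_rep
  obtain ⟨a₀, ha₀⟩ := hJ.1.exists_rep
  choose a ha using fun j => (hJ.2.1 j).exists_rep
  obtain ⟨N, hN'⟩ := Int.eq_ofNat_of_zero_le hN.le
  have hle := hasOrderLE_of_isSmoothIn hU hF hα hN'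
  set P := jetPartials hU with hP
  set χ : Fin m → smoothAlgebra U := fun i => P.adj (lastTime h) i a₀ 1 with hχ
  have hχr : ∀ i, Rep (characteristic J₀ i) (χ i) := fun i => ha₀.characteristic hU i
  have hM0 : 0 ≤ order U (characteristic J₀) := by
    have := neg_one_le_orderBound hU hα hle
    omega
  obtain ⟨M, hM⟩ := Int.eq_ofNat_of_zero_le hM0
  have hcons : P.dt α a₀ + ∑ j, P.dx j (a j) = 0 := by
    ext p
    have h1 := (ha₀.dt hU hα).add (Rep.sum univ fun j => (ha j).dx hU j) p
    exact h1.symm.trans (hJ.2.2 p p.2)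
  set τ := timeOrder U (characteristic J₀) with hτ
  -- An order of `χ` above `O` says exactly that the coefficients of `L` have order below `M + N`.
  have key := Partials.symbol_identity hle (by omega) hcons χ (fun _ => rfl) (M := M) (τ := τ)
    (fun k s i I hI => by
      rcases hI with hI | ⟨hI, hs⟩
      · exact d_eq_zero_of_order_lt hU hχr (by rw [hM]; exact_mod_cast hI) s i k
      · exact d_eq_zero_of_timeOrder_lt hU hχr (by rw [hM, hI]) hs i k)
    (fun i k K s j I hI => d_eq_zero_of_order_lt hU (fun _ : Unit => Rep.coeffX hU hα i k K) (by
      have := order_coeffX_le hU hα hle i k K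
      omega) s j ())
    (fun i k r hr s j I hI =>
      d_eq_zero_of_order_lt hU (fun _ : Unit => Rep.coeffT hU hα i k r) (by
        have := order_coeffT_le hU hα hle i k r hr
        omega) s j ())
  -- The parity of `N + h` enters here, as the minus sign of the identity.
  have hsign : (-1 : ℝ) ^ h = -(-1) ^ N := by
    have hodd' : Odd (N + h) := by
      rw [hN'] at hodd
      exact_mod_cast hodd
    have h1 : (-1 : ℝ) ^ N * (-1) ^ h = -1 := by rw [← pow_add, hodd'.neg_one_pow]
    rcases neg_one_pow_eq_or ℝ N with h2 | h2 <;> rw [h2] at h1 ⊢ <;> linarith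
  have hSF : symbol U F = symbolAt U N 0 F := by
    rw [symbol, timeOrder_eq_zero hU hα hle hN, hN']
    rfl
  have hSχ : symbol U (characteristic J₀) = symbolAt U M τ (characteristic J₀) := by
    rw [symbol, hM]
    rfl
  have hα0 : ∀ k i (K : Fin n →₀ ℕ), N < K.degree → P.d (.u 0 i K) (α k) = 0 := fun k i K hK =>
    hle.space k 0 i K rfl hK
  have hχ0 : ∀ k i (K : Fin n →₀ ℕ), M < K.degree → P.d (.u τ i K) (χ k) = 0 := fun k i K hK =>
    d_eq_zero_of_order_lt hU hχr (by rw [hM]; exact_mod_cast hK) τ i k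
  rw [hSF, hSχ]
  refine Matrix.ext fun i j => MvPolynomial.ext _ _ fun I => ?_
  rw [Matrix.neg_apply, MvPolynomial.coeff_neg, Matrix.mul_apply, Matrix.mul_apply,
    MvPolynomial.coeff_sum, MvPolynomial.coeff_sum]
  simp only [Matrix.transpose_apply, MvPolynomial.coeff_mul, coeff_symbolAt hU hα,
    coeff_symbolAt hU hχr, ← hP]
  -- Both products are homogeneous of degree `M + N`. In that degree the order bounds annihilate
  -- every term that the degree conditions in the symbols discard, so the convolutions are the sums
  -- in `key`.
  by_cases hI : I.degree = M + N
  · have h1 : ∀ k, ∀ p ∈ antidiagonal I,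
        ((if p.1.degree = M then (P.d (.u τ k p.1) (χ i) : U → ℝ) else 0) *
          if p.2.degree = N then (P.d (.u 0 j p.2) (α k) : U → ℝ) else 0) =
        ((P.d (.u τ k p.1) (χ i) * P.d (.u 0 j p.2) (α k) : smoothAlgebra U) : U → ℝ) := by
      intro k p hp
      rw [HasAntidiagonal.mem_antidiagonal] at hp
      have hdeg : p.1.degree + p.2.degree = M + N := by rw [← map_add, hp, hI]
      rw [MulMemClass.coe_mul]
      rcases lt_trichotomy p.1.degree M with hlt | heq | hgt
      · rw [if_neg hlt.ne, hα0 k j p.2 (by omega)]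
        simp
      · rw [if_pos heq, if_pos (by omega)]
      · rw [if_neg hgt.ne', hχ0 i k p.1 hgt]
        simp
    have h2 : ∀ k, ∀ p ∈ antidiagonal I,
        ((if p.1.degree = N then (P.d (.u 0 i p.1) (α k) : U → ℝ) else 0) *
          if p.2.degree = M then (P.d (.u τ j p.2) (χ k) : U → ℝ) else 0) =
        ((P.d (.u 0 i p.1) (α k) * P.d (.u τ j p.2) (χ k) : smoothAlgebra U) : U → ℝ) := by
      intro k p hp
      rw [HasAntidiagonal.mem_antidiagonal] at hp
      have hdeg : p.1.degree + p.2.degree = M + N := by rw [← map_add, hp, hI]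
      rw [MulMemClass.coe_mul]
      rcases lt_trichotomy p.1.degree N with hlt | heq | hgt
      · rw [if_neg hlt.ne, hχ0 k j p.2 (by omega)]
        simp
      · rw [if_pos heq, if_pos (by omega)]
      · rw [if_neg hgt.ne', hα0 k i p.1 hgt]
        simp
    rw [sum_congr rfl fun k _ => sum_congr rfl (h1 k), sum_congr rfl fun k _ => sum_congr rfl (h2 k)]
    have h3 := key i j I hI
    rw [hsign, neg_smul, ← smul_neg] at h3
    have h4 := smul_right_injective (smoothAlgebra U)
      (pow_ne_zero N (neg_ne_zero.2 (one_ne_zero (α := ℝ)))) h3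
    have h5 := congrArg (fun b : smoothAlgebra U => (b : U → ℝ)) (neg_eq_iff_eq_neg.1 h4)
    simpa using h5
  · have h1 : ∀ p ∈ antidiagonal I, ¬ (p.1.degree = M ∧ p.2.degree = N) := by
      rintro p hp ⟨h1, h2⟩
      rw [HasAntidiagonal.mem_antidiagonal] at hp
      exact hI (by rw [← hp, map_add, h1, h2])
    have h2 : ∀ p ∈ antidiagonal I, ¬ (p.1.degree = N ∧ p.2.degree = M) := by
      rintro p hp ⟨h1, h2⟩
      rw [HasAntidiagonal.mem_antidiagonal] at hp
      exact hI (by rw [← hp, map_add, h1, h2, add_comm])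
    rw [sum_eq_zero fun k _ => sum_eq_zero fun p hp => ?_,
      sum_eq_zero fun k _ => sum_eq_zero fun p hp => ?_, neg_zero]
    · by_cases h3 : p.1.degree = N
      · rw [if_neg fun h4 => h2 p hp ⟨h3, h4⟩, mul_zero]
      · rw [if_neg h3, zero_mul]
    · by_cases h3 : p.1.degree = M
      · rw [if_neg fun h4 => h1 p hp ⟨h3, h4⟩, mul_zero]
      · rw [if_neg h3, zero_mul]

theorem specialize_mul_specialize {B K : Type*} [CommRing B] [Field K] (φ : B →+* K)
    {A S : Matrix (Fin m) (Fin m) (MvPolynomial (Fin n) B)} (h : S * A = -(A.transpose * S)) :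
    specialize φ S * specialize φ A = -((specialize φ A).transpose * specialize φ S) := by
  set ψ : MvPolynomial (Fin n) B →+* FractionRing (MvPolynomial (Fin n) K) :=
    (algebraMap _ _).comp (MvPolynomial.map φ) with hψ
  have hs : ∀ M : Matrix (Fin m) (Fin m) (MvPolynomial (Fin n) B), specialize φ M = M.map ψ :=
    fun M => rfl
  rw [hs, hs, ← Matrix.map_mul, h, ← Matrix.transpose_map, ← Matrix.map_mul]
  exact Matrix.map_neg _ (fun a => map_neg ψ a) _

end GenEvol

end

/-! ### Descent to `B`, specialization and conclusion. -/

open GenEvol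

theorem theorem5 (n m h : ℕ) [NeZero h] (U : Set (Jet n m h)) (hU : IsOpen U)
    (F : Fin m → JetFun n m h) (hF : ∀ i, IsSmoothIn (admissible n m h) U (F i))
    (hN : 0 < order U F) (hodd : Odd (order U F + h))
    (J₀ : JetFun n m h) (J : Fin n → JetFun n m h) (hJ : IsConservedCurrent U F J₀ J)
    (hord : orderBound U F < order U (characteristic J₀))
    (B : Subalgebra ℝ (U → ℝ)) (A S : Matrix (Fin m) (Fin m) (MvPolynomial (Fin n) B))
    (hA : A.map (MvPolynomial.map (algebraMap B (U → ℝ))) = symbol U F)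
    (hS : S.map (MvPolynomial.map (algebraMap B (U → ℝ))) = symbol U (characteristic J₀))
    {k : Type*} [Field k] (φ : B →+* k) (hns : (specialize φ S).det ≠ 0) :
    (∀ d : Fin m → Polynomial (FractionRing (MvPolynomial (Fin n) k)),
      IsInvariantFactors (specialize φ A) d → ∀ i, IsSkew (d i)) ∧
    IsSkew (specialize φ A).charpoly ∧
    (specialize φ A).trace = 0 ∧
    (Odd m → (specialize φ A).det = 0) := by
  have hinj : Function.Injective (MvPolynomial.map (σ := Fin n) (algebraMap B (U → ℝ))) :=
    MvPolynomial.map_injective _ Subtype.val_injective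
  -- The identity known over `U → ℝ` is pulled back along the injection of `B`, because `φ` is
  -- defined on `B` only.
  have hSA : S * A = -(A.transpose * S) := by
    refine Matrix.map_injective hinj ?_
    beta_reduce
    rw [Matrix.map_mul, hS, hA, symbol_mul_symbol hU hF hN hodd hJ hord, ← hS, ← hA,
      ← Matrix.transpose_map, ← Matrix.map_mul]
    exact (Matrix.map_neg _ (fun a => map_neg (MvPolynomial.map (algebraMap B (U → ℝ))) a) _).symm
  have hspec := specialize_mul_specialize φ hSA
  -- The field `ℝ` maps to `k` through `B`. Characteristic zero is needed to conclude `x = 0` from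
  -- `x = -x` for trace and determinant.
  have : CharZero (FractionRing (MvPolynomial (Fin n) k)) := charZero_of_injective_ringHom
    (((algebraMap (MvPolynomial (Fin n) k) (FractionRing (MvPolynomial (Fin n) k))).comp
      (MvPolynomial.C.comp (φ.comp (algebraMap ℝ B)))).injective)
  exact ⟨fun d hd i => isSkew_of_isInvariantFactors hns hspec hd i,
    isSkew_charpoly_of_anticommute hns hspec, trace_eq_zero_of_anticommute hns hspec,
    det_eq_zero_of_anticommute hns hspec⟩
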